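/- **Setting.** Let $n\ge 2$ robots $\mathcal V=\{1,\dots,n\}$ communicate over a fixed, undirected, connected graph with Laplacian $L\in\mathbb R^{n\times n}$, let $\mathcal V_h\subseteq\mathcal V$ be a nonempty set of leaders, and let $r\in\mathbb R^2$ be a constant reference. The physical system is static: $q=(q_1,\dots,q_n)$ and $\xi=(\xi_1,\dots,\xi_n)$ in $\mathbb R^{2n}$ are constant. Robot $i$ knows a polyhedron $\{x\in\mathbb R^{4n}: A_i x\le b_i+B_i m\}$ depending on $m\in\mathbb R^2$, with rows $A_i^{(l)}\neq 0$, $l=1,\dots,\rho_i$ ($\rho_i\ge 0$). Write $z=(m,z_q,z_\xi)\in\mathbb R^{4n+2}$ and $c(m)=((\mathbf 1_n\otimes I_2)m,\,0)\in\mathbb R^{4n}$. Consider the convex problem $$\min_{z}\ \sum_{i=1}^n f_i(z)\quad\text{subject to}\quad g_i(z)\le 0,\quad h_i(z)=0\qquad(i=1,\dots,n),$$ where $f_i(z)=\|r-m\|^2$ if $i\in\mathcal V_h$ and $f_i=0$ otherwise; $g_i$ has the $2\rho_i$ components $$A_i^{(l)}c(m)-b_i^{(l)}-B_i^{(l)}m,\qquad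 \|c(m)-(z_q,z_\xi)\|-\frac{1}{\|A_i^{(l)}\|}\bigl(-A_i^{(l)}c(m)+b_i^{(l)}+B_i^{(l)}m\bigr)\qquad(l=1,\dots,\rho_i);$$ and $h_i:\mathbb R^{4n+2}\to\mathbb R^{p_i}$ is any affine map such that $h_i(z)=0$ if and only if the $i$-th blocks of $z_q$ and $z_\xi$ equal $q_i$ and $\xi_i$. Assume Slater's condition: there is $z$ with $g_{ik}(z)<0$ and $h_{il}(z)=0$ for all $i,k,l$. **Scheme.** Let $\alpha>0$. Agent $i$ holds an estimate $\tilde z_i\in\mathbb R^{4n+2}$, an integral state $\zeta_i\in\mathbb R^{4n+2}$ and multipliers $\lambda_{ik}\ge 0$, $\nu_{il}\in\mathbb R$, which evolve by $$\dot{\tilde z}_i=-\sum_j L_{ij}\tilde z_j+\sum_j L_{ij}\zeta_j-\alpha\nabla f_i(\tilde z_i)-\alpha\sum_k\lambda_{ik}\nabla g_{ik}(\tilde z_i)-\alpha\sum_l\nu_{il}\nabla h_{il}(\tilde z_i),\qquad \dot\zeta_i=-\sum_j L_{ij}\tilde z_j,$$ $$\dot\lambda_{ik}=\begin{cases}0&\text{if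 }\lambda_{ik}=0\text{ and }g_{ik}(\tilde z_i)<0,\\ g_{ik}(\tilde z_i)&\text{otherwise,}\end{cases}\qquad \dot\nu_{il}=h_{il}(\tilde z_i).$$ A trajectory is a locally absolutely continuous solution on $[0,\infty)$, satisfying these equations at almost every time, with all $\lambda_{ik}(t)\ge0$. At a point where $g_{ik}$ is not differentiable (the kink of the norm), any subgradient may be used as $\nabla g_{ik}$. **Theorem.** The problem has exactly one optimal solution $z^*$, and along every trajectory, from any initial state with $\lambda(0)\ge0$, $\tilde z_i(t)\to z^*$ as $t\to\infty$ for every $i\in\mathcal V$. -/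

import Mathlib

open Filter Topology MeasureTheory
open scoped Gradient

noncomputable section

namespace DistOpt

/-! ### The distributed optimization problem and the primal-dual scheme, for generic data -/

section Scheme

variable {V E : Type*} [Fintype V] {M P : V → Type*}

/-- Feasible points of the global problem: `g i k z ≤ 0` and `h i l z = 0` for all agents. -/
def IsFeasible (g : ∀ i, M i → E → ℝ) (h : ∀ i, P i → E → ℝ) (z : E) : Prop :=
  (∀ i k, g i k z ≤ 0) ∧ ∀ i l, h i l z = 0

/-- `z` is an optimal solution of `min ∑ i, f i z` subject to `g i k z ≤ 0`, `h i l z = 0`. -/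
def IsOptimal (f : V → E → ℝ) (g : ∀ i, M i → E → ℝ) (h : ∀ i, P i → E → ℝ) (z : E) : Prop :=
  IsFeasible g h z ∧ ∀ w, IsFeasible g h w → ∑ i, f i z ≤ ∑ i, f i w

/-- Slater's condition: some point satisfies the equality constraints, and the inequality
constraints strictly. -/
def Slater (g : ∀ i, M i → E → ℝ) (h : ∀ i, P i → E → ℝ) : Prop :=
  ∃ z, (∀ i k, g i k z < 0) ∧ ∀ i l, h i l z = 0

/-- The switch function of the dual ascent for the inequality multipliers. -/
def eta (lam g : ℝ) : ℝ :=
  open Classical in if lam = 0 ∧ g < 0 then 0 else g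

variable [NormedAddCommGroup E] [InnerProductSpace ℝ E] [CompleteSpace E]

/-- `v` is the gradient of `φ` at `z`; at a point where `φ` is not differentiable (the kink of a
Euclidean norm), `v` may be any subgradient of `φ` at `z`. -/
def IsGrad (φ : E → ℝ) (z v : E) : Prop :=
  (DifferentiableAt ℝ φ z → v = ∇ φ z) ∧
    (¬ DifferentiableAt ℝ φ z → ∀ w, φ z + inner ℝ v (w - z) ≤ φ w)

/-- Trajectories on `[0, ∞)` of the primal-dual scheme, in the sense of Carathéodory: the state is
locally absolutely continuous and satisfies the differential equations at almost every time.
Here `z i` and `ζ i` are the estimate and the integral variable of agent `i`, `lam i k` and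
`nu i l` are its multipliers.  The state space is the set where all `lam i k` are nonnegative.
The matrix `L` acts blockwise, as `L ⊗ I`. -/
structure IsTrajectory [DecidableEq V] [∀ i, Fintype (M i)] [∀ i, Fintype (P i)]
    (G : SimpleGraph V) [DecidableRel G.Adj] (α : ℝ)
    (f : V → E → ℝ) (g : ∀ i, M i → E → ℝ) (h : ∀ i, P i → E → ℝ)
    (z ζ : V → ℝ → E) (lam : ∀ i, M i → ℝ → ℝ) (nu : ∀ i, P i → ℝ → ℝ) : Prop where
  ac_z : ∀ i, ∀ T > 0, AbsolutelyContinuousOnInterval (z i) 0 T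
  ac_ζ : ∀ i, ∀ T > 0, AbsolutelyContinuousOnInterval (ζ i) 0 T
  ac_lam : ∀ i k, ∀ T > 0, AbsolutelyContinuousOnInterval (lam i k) 0 T
  ac_nu : ∀ i l, ∀ T > 0, AbsolutelyContinuousOnInterval (nu i l) 0 T
  lam_nonneg : ∀ i k, ∀ t ≥ 0, 0 ≤ lam i k t
  /-- PI consensus estimator with gradient descent. -/
  deriv_z : ∀ᵐ t : ℝ, 0 < t → ∀ i, ∃ Γ : M i → E,
    (∀ k, IsGrad (g i k) (z i t) (Γ k)) ∧
    HasDerivAt (z i)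
      (-(∑ j, G.lapMatrix ℝ i j • z j t) + ∑ j, G.lapMatrix ℝ i j • ζ j t
        - α • ∇ (f i) (z i t)
        - α • ∑ k, lam i k t • Γ k
        - α • ∑ l, nu i l t • ∇ (h i l) (z i t)) t
  deriv_ζ : ∀ᵐ t : ℝ, 0 < t → ∀ i,
    HasDerivAt (ζ i) (-(∑ j, G.lapMatrix ℝ i j • z j t)) t
  /-- Switched dual ascent for the inequality multipliers. -/
  deriv_lam : ∀ᵐ t : ℝ, 0 < t → ∀ i k,
    HasDerivAt (lam i k) (eta (lam i k t) (g i k (z i t))) t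
  /-- Dual ascent for the equality multipliers. -/
  deriv_nu : ∀ᵐ t : ℝ, 0 < t → ∀ i l, HasDerivAt (nu i l) (h i l (z i t)) t

end Scheme

/-! ### The static reference governor problem of a network of `n` planar robots -/

/-- Coordinates of the physical state `(q, ξ) ∈ ℝ²ⁿ × ℝ²ⁿ`. -/
abbrev PhysIdx (n : ℕ) : Type := (Fin n × Fin 2) ⊕ (Fin n × Fin 2)

/-- The decision space `ℝ^(4n+2)`, with points `z = (m, z_q, z_ξ)`. -/
abbrev ZSpace (n : ℕ) : Type := EuclideanSpace ℝ (Fin 2 ⊕ PhysIdx n)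

variable {n : ℕ}

/-- The component `m` of `z = (m, z_q, z_ξ)`. -/
def refPart (z : ZSpace n) : EuclideanSpace ℝ (Fin 2) :=
  WithLp.toLp 2 fun a => z (Sum.inl a)

/-- The component `(z_q, z_ξ)` of `z = (m, z_q, z_ξ)`. -/
def physPart (z : ZSpace n) : EuclideanSpace ℝ (PhysIdx n) :=
  WithLp.toLp 2 fun s => z (Sum.inr s)

/-- The physical state `((1ₙ ⊗ I₂) m, 0)`. -/
def replicate (n : ℕ) (m : EuclideanSpace ℝ (Fin 2)) : EuclideanSpace ℝ (PhysIdx n) :=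
  WithLp.toLp 2 (Sum.elim (fun p => m p.2) fun _ => 0)

/-- The local cost: `‖r - m‖²` for the leaders `i ∈ Vh`, and `0` for the other robots. -/
def cost (Vh : Finset (Fin n)) (r : EuclideanSpace ℝ (Fin 2)) (i : Fin n) (z : ZSpace n) : ℝ :=
  if i ∈ Vh then ‖r - refPart z‖ ^ 2 else 0

/-- The local inequality constraints of a robot whose constraint set is the polyhedron
`{x | A x ≤ b + B m}`.  Two functions for each row `l`, which together say that the ball with
centre `c = ((1 ⊗ I₂) m, 0)` through `(z_q, z_ξ)` lies in the half-space of row `l`: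
`A⁽ˡ⁾ c - b⁽ˡ⁾ - B⁽ˡ⁾ m` (left summand) and
`‖c - (z_q, z_ξ)‖ - (-A⁽ˡ⁾ c + b⁽ˡ⁾ + B⁽ˡ⁾ m) / ‖A⁽ˡ⁾‖` (right summand). -/
def ineq {ρ : ℕ} (A : Matrix (Fin ρ) (PhysIdx n) ℝ) (b : Fin ρ → ℝ)
    (B : Matrix (Fin ρ) (Fin 2) ℝ) : Fin ρ ⊕ Fin ρ → ZSpace n → ℝ
  | Sum.inl l, z =>
      A.mulVec (replicate n (refPart z)) l - b l - B.mulVec (refPart z) l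
  | Sum.inr l, z =>
      ‖replicate n (refPart z) - physPart z‖
        - 1 / ‖(WithLp.toLp 2 (A l) : EuclideanSpace ℝ (PhysIdx n))‖ *
          (-(A.mulVec (replicate n (refPart z)) l) + b l + B.mulVec (refPart z) l)

/-- Robot `i`'s blocks of `z_q` and `z_ξ` agree with its actual state `(q i, ξ i)`. -/
def AgreesAt (q ξ : Fin n → EuclideanSpace ℝ (Fin 2)) (i : Fin n) (z : ZSpace n) : Prop :=
  (∀ a, z (Sum.inr (Sum.inl (i, a))) = q i a) ∧ ∀ a, z (Sum.inr (Sum.inr (i, a))) = ξ i a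

end DistOpt

end

set_option linter.unusedSectionVars false

noncomputable section

/-! ### Absolutely continuous functions -/

namespace AbsolutelyContinuousOnInterval

/-! The scheme is a saddle-point flow: each agent holds a copy of `z`, the copies are tied by the
Laplacian, and `ζ` acts as a scaled consensus multiplier. Slater's condition yields a saddle point
`p` (`exists_isSaddle`). By convexity, a trajectory satisfies an evolution variational inequality
against every test state with nonnegative inequality multipliers
(`isWeakTrajectory_of_isTrajectory`); tested at `p`, it makes a weighted distance to `p`
nonincreasing. Unlike the switched, set-valued equations, this integrated form passes to pointwise
limits of time translates, which exist by Arzelà–Ascoli (`exists_limit`).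

Along such a limit `y` the distance to `p` is constant, so all dissipation vanishes: the estimates
agree, the multipliers are complementary to the constraints at `z*`, and the leaders' strictly
convex cost pins the component `m`. Testing around `p` then gives linear relations for the motion of
`y` (`variation`). It remains to show that the estimates in `y` equal `z*`.

If no norm constraint active at `z*` sits at its kink, the active constraints are differentiable
there. The direction from `z*` to a Slater point moves only `m` and strictly decreases each active
constraint to first order, so a combination of the active multipliers with negative weights is
constant. Along `y` all active norm constraints take the same value, so their multipliers move in
the same direction and hence not at all (`eq_of_sum_mul_eq`). The velocity in directions unseen by
one agent's equalities is then constant, and zero by boundedness; for `n ≥ 2` these directions span.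
Boundedness of `ν` forces the equalities, so the estimate is `z*`.

If an active norm constraint is at its kink, its value along `y` is a norm, so its multiplier cannot
decrease. Translating along times where that multiplier approaches its limit superior makes it
constant on `y`, so the norm vanishes and again the estimate is `z*`.

In both cases `y 0` is itself a saddle point. The distance to it is monotone along the original
trajectory and tends to zero along a sequence, so the trajectory converges. -/

theorem norm_sub_sq {E : Type*} [NormedAddCommGroup E] {u : ℝ → E} {a b : ℝ}
    (hu : AbsolutelyContinuousOnInterval u a b) (w : E) :
    AbsolutelyContinuousOnInterval (fun t => ‖u t - w‖ ^ 2) a b := by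
  have h1 : AbsolutelyContinuousOnInterval (fun t => ‖u t - w‖) a b := by
    refine squeeze_zero (fun t => Finset.sum_nonneg fun i _ => dist_nonneg)
      (fun t => Finset.sum_le_sum fun i _ => ?_) hu
    rw [Real.dist_eq, dist_eq_norm]
    simpa using abs_norm_sub_norm_le (u (t.2 i).1 - w) (u (t.2 i).2 - w)
  have h2 := h1.mul h1
  convert h2 using 1
  ext t
  simp [sq]

theorem finset_sum {ι F : Type*} [NormedAddCommGroup F] {u : ι → ℝ → F} {a b : ℝ} (s : Finset ι)
    (hu : ∀ i ∈ s, AbsolutelyContinuousOnInterval (u i) a b) :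
    AbsolutelyContinuousOnInterval (fun t => ∑ i ∈ s, u i t) a b := by
  classical
  induction s using Finset.induction_on with
  | empty =>
    have : LipschitzOnWith 0 (fun _ : ℝ => (0 : F)) (Set.uIcc a b) :=
      (LipschitzWith.const (0 : F)).lipschitzOnWith
    simpa using this.absolutelyContinuousOnInterval
  | insert i s hi ih =>
    have h1 := (hu i (Finset.mem_insert_self i s)).add
      (ih fun j hj => hu j (Finset.mem_insert_of_mem hj))
    convert h1 using 1
    ext t
    simp [Finset.sum_insert hi]

/-- The fundamental theorem of calculus for absolutely continuous functions turns an
almost-everywhere bound on the derivative into a bound on the increment. The endpoints are null, so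
nothing is needed at time `0`. -/
theorem sub_le_integral {φ H : ℝ → ℝ} {a b : ℝ} (hab : a ≤ b)
    (hφ : AbsolutelyContinuousOnInterval φ a b) (hH : IntervalIntegrable H volume a b)
    (hd : ∀ᵐ t, t ∈ Set.Ioo a b → ∃ d, HasDerivAt φ d t ∧ d ≤ H t) :
    φ b - φ a ≤ ∫ t in a..b, H t := by
  rw [← hφ.integral_deriv_eq_sub]
  refine intervalIntegral.integral_mono_ae_restrict hab hφ.intervalIntegrable_deriv hH ?_
  rw [← restrict_Ioo_eq_restrict_Icc]
  refine (ae_restrict_iff' measurableSet_Ioo).2 ?_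
  filter_upwards [hd] with t ht hm
  obtain ⟨d, h1, h2⟩ := ht hm
  rwa [h1.deriv]

end AbsolutelyContinuousOnInterval

namespace DistOpt

/-! ### Convexity -/

theorem convexOn_gradient_le {E : Type*} [NormedAddCommGroup E] [InnerProductSpace ℝ E]
    [CompleteSpace E] {φ : E → ℝ} (hφ : ConvexOn ℝ Set.univ φ) {z : E}
    (hd : DifferentiableAt ℝ φ z) (w : E) : φ z + inner ℝ (∇ φ z) (w - z) ≤ φ w := by
  have hline : HasDerivAt (fun t : ℝ => φ (z + t • (w - z))) (inner ℝ (∇ φ z) (w - z)) 0 := by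
    have h1 : HasDerivAt (fun t : ℝ => z + t • (w - z)) (w - z) 0 := by
      simpa using ((hasDerivAt_id (0 : ℝ)).smul_const (w - z)).const_add z
    have h2 : HasFDerivAt φ (fderiv ℝ φ z) (z + (0 : ℝ) • (w - z)) := by
      simpa using hd.hasFDerivAt
    have h3 := h2.comp_hasDerivAt (0 : ℝ) h1
    have h4 : inner ℝ (∇ φ z) (w - z) = fderiv ℝ φ z (w - z) := by
      simp [gradient]
    rw [h4]
    exact h3
  have hc : ConvexOn ℝ Set.univ (fun t : ℝ => φ (z + t • (w - z))) := by
    refine ⟨convex_univ, fun s _ t _ a b ha hb hab => ?_⟩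
    have := hφ.2 (Set.mem_univ (z + s • (w - z))) (Set.mem_univ (z + t • (w - z))) ha hb hab
    convert this using 2
    have : z = (a + b) • z := by rw [hab, one_smul]
    nth_rewrite 1 [this]
    module
  have := hc.le_slope_of_hasDerivAt (Set.mem_univ 0) (Set.mem_univ 1) one_pos hline
  rw [slope_def_field] at this
  simp only [one_smul, zero_smul, add_zero, sub_zero, div_one, add_sub_cancel] at this
  linarith

/-- The subgradient inequality is all that is used about the selected constraint gradients, so kinks
need no separate treatment in the energy estimate. -/
theorem IsGrad.le {E : Type*} [NormedAddCommGroup E] [InnerProductSpace ℝ E]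
    [CompleteSpace E] {φ : E → ℝ} (hφ : ConvexOn ℝ Set.univ φ) {z v : E}
    (hv : IsGrad φ z v) (w : E) : φ z + inner ℝ v (w - z) ≤ φ w := by
  by_cases hd : DifferentiableAt ℝ φ z
  · rw [hv.1 hd]
    exact convexOn_gradient_le hφ hd w
  · exact hv.2 hd w

/-! ### The Laplacian acting blockwise -/

section Laplacian

variable {V E : Type*} [Fintype V] [DecidableEq V] [NormedAddCommGroup E] [InnerProductSpace ℝ E]
  (G : SimpleGraph V) [DecidableRel G.Adj]

/-- The action of `L ⊗ I` on a family of vectors. -/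
def blockLap (y : V → E) (i : V) : E := ∑ j, G.lapMatrix ℝ i j • y j

theorem blockLap_eq (y : V → E) (i : V) :
    blockLap G y i = ∑ j, if G.Adj i j then y i - y j else 0 := by
  have h1 : ∀ j, G.lapMatrix ℝ i j • y j =
      (if i = j then (G.degree i : ℝ) • y j else 0) - (if G.Adj i j then y j else 0) := by
    intro j
    rw [SimpleGraph.lapMatrix, Matrix.sub_apply, sub_smul, SimpleGraph.degMatrix,
      Matrix.diagonal_apply, SimpleGraph.adjMatrix_apply, ite_smul, ite_smul]
    simp
  rw [blockLap, Finset.sum_congr rfl fun j _ => h1 j, Finset.sum_sub_distrib]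
  have h2 : ∀ j, (if G.Adj i j then y i - y j else 0) =
      (if G.Adj i j then (1 : ℝ) else 0) • y i - (if G.Adj i j then y j else 0) := by
    intro j; split_ifs <;> simp
  rw [Finset.sum_congr rfl fun j _ => h2 j, Finset.sum_sub_distrib, ← Finset.sum_smul,
    ← G.degree_eq_sum_if_adj]
  simp

/-- Symmetrising over the two orientations of each edge gives the Dirichlet form, from which
symmetry, nonnegativity and the kernel of the Laplacian are read off. -/
theorem sum_inner_blockLap (y y' : V → E) :
    ∑ i, inner ℝ (blockLap G y i) (y' i) =
      (1 / 2) * ∑ i, ∑ j, if G.Adj i j then inner ℝ (y i - y j) (y' i - y' j) else (0 : ℝ) := by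
  have h1 : ∑ i, inner ℝ (blockLap G y i) (y' i) =
      ∑ i, ∑ j, if G.Adj i j then inner ℝ (y i - y j) (y' i) else (0 : ℝ) := by
    refine Finset.sum_congr rfl fun i _ => ?_
    rw [blockLap_eq, sum_inner]
    refine Finset.sum_congr rfl fun j _ => ?_
    split_ifs <;> simp
  have h2 : ∑ i, ∑ j, (if G.Adj i j then inner ℝ (y i - y j) (y' i) else (0 : ℝ)) =
      ∑ i, ∑ j, if G.Adj i j then -inner ℝ (y i - y j) (y' j) else (0 : ℝ) := by
    rw [Finset.sum_comm]
    refine Finset.sum_congr rfl fun i _ => Finset.sum_congr rfl fun j _ => ?_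
    by_cases hij : G.Adj i j
    · rw [if_pos hij, if_pos hij.symm, ← inner_neg_left, neg_sub]
    · rw [if_neg hij, if_neg fun h => hij h.symm]
  have h3 : ∑ i, ∑ j, (if G.Adj i j then inner ℝ (y i - y j) (y' i - y' j) else (0 : ℝ)) =
      ∑ i, ∑ j, (if G.Adj i j then inner ℝ (y i - y j) (y' i) else (0 : ℝ)) +
      ∑ i, ∑ j, if G.Adj i j then -inner ℝ (y i - y j) (y' j) else (0 : ℝ) := by
    simp_rw [← Finset.sum_add_distrib]
    refine Finset.sum_congr rfl fun i _ => Finset.sum_congr rfl fun j _ => ?_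
    split_ifs
    · rw [inner_sub_right]; ring
    · simp
  rw [h3, ← h2, h1]
  ring

theorem sum_inner_blockLap_comm (y y' : V → E) :
    ∑ i, inner ℝ (blockLap G y i) (y' i) = ∑ i, inner ℝ (blockLap G y' i) (y i) := by
  rw [sum_inner_blockLap, sum_inner_blockLap]
  simp_rw [real_inner_comm]

theorem sum_inner_blockLap_nonneg (y : V → E) : 0 ≤ ∑ i, inner ℝ (blockLap G y i) (y i) := by
  rw [sum_inner_blockLap]
  refine mul_nonneg (by norm_num) (Finset.sum_nonneg fun i _ => Finset.sum_nonneg fun j _ => ?_)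
  split_ifs
  · exact real_inner_self_nonneg
  · exact le_rfl

theorem sum_inner_blockLap_const (y : V → E) (c : E) :
    ∑ i, inner ℝ (blockLap G y i) c = 0 := by
  rw [sum_inner_blockLap G y fun _ => c]
  simp

variable {G} in
theorem eq_of_sum_inner_blockLap_eq_zero (hG : G.Connected) {y : V → E}
    (h : ∑ i, inner ℝ (blockLap G y i) (y i) = 0) (i j : V) : y i = y j := by
  have hnn : ∀ i j, 0 ≤ if G.Adj i j then inner ℝ (y i - y j) (y i - y j) else (0 : ℝ) := by
    intro i j; split_ifs
    · exact real_inner_self_nonneg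
    · exact le_rfl
  rw [sum_inner_blockLap] at h
  have h1 : ∑ i, ∑ j, (if G.Adj i j then inner ℝ (y i - y j) (y i - y j) else (0 : ℝ)) = 0 := by
    linarith
  have h2 : ∀ i j, G.Adj i j → y i = y j := by
    intro i j hij
    have h3 := (Finset.sum_eq_zero_iff_of_nonneg
      fun i _ => Finset.sum_nonneg fun j _ => hnn i j).1 h1 i (Finset.mem_univ i)
    have h4 := (Finset.sum_eq_zero_iff_of_nonneg fun j _ => hnn i j).1 h3 j (Finset.mem_univ j)
    rw [if_pos hij] at h4
    exact sub_eq_zero.1 (inner_self_eq_zero.1 h4)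
  obtain ⟨p⟩ := hG.preconnected i j
  induction p with
  | nil => rfl
  | cons hadj _ ih => exact (h2 _ _ hadj).trans ih

theorem blockLap_eq_zero {y : V → E} (h : ∀ i j, y i = y j) (i : V) : blockLap G y i = 0 := by
  rw [blockLap_eq]
  exact Finset.sum_eq_zero fun j _ => by simp [h i j]

@[fun_prop]
theorem continuous_blockLap (i : V) : Continuous fun y : V → E => blockLap G y i := by
  unfold blockLap
  fun_prop

end Laplacian

theorem continuous_comp_max {F : Type*} [PseudoMetricSpace F] {u : ℝ → F}
    (hu : ∀ T > 0, ContinuousOn u (Set.uIcc 0 T)) : Continuous fun t => u (max t 0) := by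
  refine continuous_iff_continuousAt.2 fun t => ?_
  have hT : (0 : ℝ) < |t| + 1 := by positivity
  have h1 := hu _ hT
  rw [Set.uIcc_of_le hT.le] at h1
  have h2 : ContinuousOn (fun s => u (max s 0)) (Set.Iio (|t| + 1)) := by
    refine h1.comp (by fun_prop) fun s hs => ⟨le_max_right _ _, max_le (le_of_lt hs) hT.le⟩
  exact h2.continuousAt (Iio_mem_nhds (by linarith [le_abs_self t]))

/-! ### Limits of translates of a uniformly continuous bounded curve -/

/-- All translates share one modulus of continuity and one compact range, so Arzelà–Ascoli applies
in the compact-open topology. Only pointwise convergence is kept. -/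
theorem exists_tendsto_translates {X : Type*} [MetricSpace X] [ProperSpace X] {x : ℝ → X}
    (hx : UniformContinuous x) (hb : Bornology.IsBounded (Set.range x)) (τ : ℕ → ℝ) :
    ∃ φ : ℕ → ℕ, StrictMono φ ∧ ∃ y : ℝ → X, Continuous y ∧
      ∀ s, Tendsto (fun k => x (τ (φ k) + s)) atTop (𝓝 (y s)) := by
  rw [Metric.uniformContinuous_iff] at hx
  choose! δ hδ0 hδ using hx
  let K : Set X := closure (Set.range x)
  have hK : IsCompact K := hb.isCompact_closure
  -- The modulus is imposed with `≤ ε` rather than `< ε`, so that it is closed under pointwise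
  -- limits.
  let T : Set (ℝ → X) := {f | (∀ ε > 0, ∀ a b, dist a b < δ ε → dist (f a) (f b) ≤ ε) ∧
    ∀ s, f s ∈ K}
  have hT : IsCompact T := by
    have h1 : IsCompact {f : ℝ → X | ∀ s, f s ∈ K} := isCompact_pi_infinite fun _ => hK
    refine h1.of_isClosed_subset ?_ fun f hf => hf.2
    refine IsClosed.and ?_ h1.isClosed
    simp only [Set.ofPred_forall]
    refine isClosed_iInter fun ε => isClosed_iInter fun _ => isClosed_iInter fun a =>
      isClosed_iInter fun b => isClosed_iInter fun _ => ?_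
    exact isClosed_le (by fun_prop) continuous_const
  have hTc : ∀ f ∈ T, Continuous f := by
    intro f hf
    refine Metric.continuous_iff.2 fun a ε hε => ⟨δ (ε / 2), hδ0 _ (half_pos hε), fun b hb => ?_⟩
    exact (hf.1 _ (half_pos hε) b a hb).trans_lt (half_lt_self hε)
  let S : Set C(ℝ, X) := {f | (f : ℝ → X) ∈ T}
  have hS : IsCompact S := by
    refine ArzelaAscoli.isCompact_of_equicontinuous S ?_ ?_
    · convert hT using 1
      ext f
      constructor
      · rintro ⟨g, hg, rfl⟩
        exact hg
      · intro hf
        exact ⟨⟨f, hTc f hf⟩, hf, rfl⟩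
    · intro a
      refine Metric.equicontinuousAt_iff.2 fun ε hε => ⟨δ (ε / 2), hδ0 _ (half_pos hε), ?_⟩
      intro b hb f
      refine (f.2.1 _ (half_pos hε) a b ?_).trans_lt (half_lt_self hε)
      rwa [dist_comm]
  have hmem : ∀ k, (fun s => x (τ k + s)) ∈ T := fun k =>
    ⟨fun ε hε a b hab => (hδ ε hε (by simpa using hab)).le,
      fun s => subset_closure (Set.mem_range_self _)⟩
  obtain ⟨f, _, φ, hφ, hlim⟩ := hS.tendsto_subseq
    (x := fun k => (⟨fun s => x (τ k + s), hTc _ (hmem k)⟩ : C(ℝ, X))) hmem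
  refine ⟨φ, hφ, f, f.continuous, fun s => ?_⟩
  exact ((continuous_eval_const s).tendsto f).comp hlim

/-! ### Weak trajectories: the evolution variational inequality -/

/-- The data of a distributed convex program with gain `α`. -/
structure Program (V E : Type*) (M P : V → Type*) [NormedAddCommGroup E]
    [InnerProductSpace ℝ E] where
  /-- the communication graph -/
  G : SimpleGraph V
  /-- adjacency is decidable -/
  decAdj : DecidableRel G.Adj
  /-- the gain -/
  α : ℝ
  /-- the local costs -/
  f : V → E → ℝ
  /-- the inequality constraints -/
  g : ∀ i, M i → E → ℝ
  /-- the equality constraints -/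
  h : ∀ i, P i → (E →ᵃ[ℝ] ℝ)
  α_pos : 0 < α
  f_convex : ∀ i, ConvexOn ℝ Set.univ (f i)
  f_diff : ∀ i, Differentiable ℝ (f i)
  g_convex : ∀ i k, ConvexOn ℝ Set.univ (g i k)
  g_cont : ∀ i k, Continuous (g i k)

attribute [instance] Program.decAdj

/-- The states `(z, ζ, lam, nu)` of the primal-dual scheme. -/
abbrev State (E : Type*) {V : Type*} (M P : V → Type*) : Type _ :=
  (V → E) × (V → E) × (∀ i, M i → ℝ) × (∀ i, P i → ℝ)

section Defs

variable {V E : Type*} [Fintype V] [DecidableEq V] {M P : V → Type*} [∀ i, Fintype (M i)]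
  [∀ i, Fintype (P i)] [NormedAddCommGroup E] [InnerProductSpace ℝ E] (D : Program V E M P)

namespace Program

/-- The Laplacian of the network acting blockwise. -/
def lap (y : V → E) (i : V) : E := blockLap D.G y i

/-- The local Lagrangian of agent `i`. -/
def lagr (i : V) (w : E) (lam : M i → ℝ) (nu : P i → ℝ) : ℝ :=
  D.f i w + ∑ k, lam k * D.g i k w + ∑ l, nu l * D.h i l w

/-- Half the squared weighted distance of two states. -/
def lyap (x w : State E M P) : ℝ :=
  ∑ i, (1 / 2 * ‖x.1 i - w.1 i‖ ^ 2 + 1 / 2 * ‖x.2.1 i - w.2.1 i‖ ^ 2 +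
    D.α / 2 * ∑ k, ‖x.2.2.1 i k - w.2.2.1 i k‖ ^ 2 +
    D.α / 2 * ∑ l, ‖x.2.2.2 i l - w.2.2.2 i l‖ ^ 2)

/-- The bound for the derivative of `lyap · w` along trajectories. -/
def drift (x w : State E M P) : ℝ :=
  ∑ i, (inner ℝ (-D.lap x.1 i + D.lap x.2.1 i) (x.1 i - w.1 i) +
    inner ℝ (-D.lap x.1 i) (x.2.1 i - w.2.1 i) +
    D.α * (D.lagr i (w.1 i) (x.2.2.1 i) (x.2.2.2 i) - D.lagr i (x.1 i) (w.2.2.1 i) (w.2.2.2 i)))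

/-- Curves satisfying the integrated form of the scheme, on `[0, ∞)`. -/
structure IsWeakTrajectory (x : ℝ → State E M P) : Prop where
  cont : Continuous x
  nonneg : ∀ t ≥ 0, ∀ i k, 0 ≤ (x t).2.2.1 i k
  lyap_le : ∀ w : State E M P, (∀ i k, 0 ≤ w.2.2.1 i k) → ∀ a b, 0 ≤ a → a ≤ b →
    D.lyap (x b) w - D.lyap (x a) w ≤ ∫ t in a..b, D.drift (x t) w
  lam_le : ∀ i k a b, 0 ≤ a → a ≤ b →
    (x b).2.2.1 i k - (x a).2.2.1 i k ≤ ∫ t in a..b, max (D.g i k ((x t).1 i)) 0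

end Program

end Defs

section Basic

variable {V E : Type*} [Fintype V] [DecidableEq V] {M P : V → Type*} [∀ i, Fintype (M i)]
  [∀ i, Fintype (P i)] [NormedAddCommGroup E] [InnerProductSpace ℝ E] [FiniteDimensional ℝ E]
  (D : Program V E M P)

namespace Program

@[fun_prop]
theorem continuous_h (i : V) (l : P i) : Continuous (D.h i l) :=
  (D.h i l).continuous_of_finiteDimensional

@[fun_prop]
theorem continuous_f (i : V) : Continuous (D.f i) := (D.f_diff i).continuous

@[fun_prop]
theorem continuous_g (i : V) (k : M i) : Continuous (D.g i k) := D.g_cont i k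

@[fun_prop]
theorem continuous_lap (i : V) : Continuous fun y : V → E => D.lap y i :=
  continuous_blockLap D.G i

@[fun_prop]
theorem continuous_lagr (i : V) :
    Continuous fun q : E × (M i → ℝ) × (P i → ℝ) => D.lagr i q.1 q.2.1 q.2.2 := by
  unfold lagr
  fun_prop

@[fun_prop]
theorem continuous_lyap : Continuous fun q : State E M P × State E M P => D.lyap q.1 q.2 := by
  unfold lyap
  fun_prop

@[fun_prop]
theorem continuous_drift : Continuous fun q : State E M P × State E M P => D.drift q.1 q.2 := by
  have h1 : ∀ i, Continuous fun q : State E M P × State E M P =>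
      D.lagr i (q.2.1 i) (q.1.2.2.1 i) (q.1.2.2.2 i) := fun i =>
    (D.continuous_lagr i).comp (f := fun q : State E M P × State E M P =>
      (q.2.1 i, q.1.2.2.1 i, q.1.2.2.2 i)) (by fun_prop)
  have h2 : ∀ i, Continuous fun q : State E M P × State E M P =>
      D.lagr i (q.1.1 i) (q.2.2.2.1 i) (q.2.2.2.2 i) := fun i =>
    (D.continuous_lagr i).comp (f := fun q : State E M P × State E M P =>
      (q.1.1 i, q.2.2.2.1 i, q.2.2.2.2 i)) (by fun_prop)
  have h3 : ∀ i, Continuous fun q : State E M P × State E M P => D.lap q.1.1 i := fun i =>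
    (D.continuous_lap i).comp (by fun_prop)
  have h4 : ∀ i, Continuous fun q : State E M P × State E M P => D.lap q.1.2.1 i := fun i =>
    (D.continuous_lap i).comp (by fun_prop)
  unfold drift
  refine continuous_finsetSum _ fun i _ => ?_
  have := h1 i; have := h2 i; have := h3 i; have := h4 i
  fun_prop

end Program

theorem eta_le_max (a b : ℝ) : eta a b ≤ max b 0 := by
  unfold eta; split_ifs
  · exact le_max_right _ _
  · exact le_max_left _ _

/-- The switch acts only when `a = 0` and `b < 0`, and then the right side is `-c * b ≥ 0`. This is
why test states need nonnegative inequality multipliers. -/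
theorem sub_mul_eta_le {a b c : ℝ} (hc : 0 ≤ c) : (a - c) * eta a b ≤ (a - c) * b := by
  unfold eta; split_ifs with h
  · rw [h.1]; nlinarith [h.2]
  · exact le_rfl

theorem affineMap_inner_gradient (φ : E →ᵃ[ℝ] ℝ) (z w : E) :
    inner ℝ (∇ φ z) (w - z) = φ w - φ z := by
  have h1 : (φ : E → ℝ) = fun x => φ.linear.toContinuousLinearMap x + φ 0 := by
    ext x
    simpa using φ.map_vadd 0 x
  have h2 : HasFDerivAt (φ : E → ℝ) φ.linear.toContinuousLinearMap z := by
    have h3 := φ.linear.toContinuousLinearMap.hasFDerivAt (x := z) |>.add_const (φ 0)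
    exact h1 ▸ h3
  rw [gradient, h2.fderiv, InnerProductSpace.toDual_symm_apply]
  simpa using φ.linearMap_vsub w z

/-- The derivative of the squared distance to a test state is bounded by subgradient inequalities
for the costs and constraints, exactness for the affine equalities, and the sign of the switch.
Freezing the state at negative times gives a curve on all of `ℝ`, convenient for translation. -/
theorem Program.isWeakTrajectory_of_isTrajectory {z ζ : V → ℝ → E} {lam : ∀ i, M i → ℝ → ℝ}
    {nu : ∀ i, P i → ℝ → ℝ}
    (ht : IsTrajectory D.G D.α D.f D.g (fun i l => ⇑(D.h i l)) z ζ lam nu) :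
    D.IsWeakTrajectory fun t => (fun i => z i (max t 0), fun i => ζ i (max t 0),
      fun i k => lam i k (max t 0), fun i l => nu i l (max t 0)) := by
  set x : ℝ → State E M P := fun t => (fun i => z i (max t 0), fun i => ζ i (max t 0),
      fun i k => lam i k (max t 0), fun i l => nu i l (max t 0)) with hx
  have hxt : ∀ t, 0 ≤ t → x t = (fun i => z i t, fun i => ζ i t, fun i k => lam i k t,
      fun i l => nu i l t) := by
    intro t ht0
    simp only [hx, max_eq_left ht0]
  have hcont : Continuous x := by
    have h1 := fun i => continuous_comp_max fun T hT => (ht.ac_z i T hT).continuousOn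
    have h2 := fun i => continuous_comp_max fun T hT => (ht.ac_ζ i T hT).continuousOn
    have h3 := fun i k => continuous_comp_max fun T hT =>
      (ht.ac_lam i k T hT).continuousOn
    have h4 := fun i l => continuous_comp_max fun T hT => (ht.ac_nu i l T hT).continuousOn
    exact (continuous_pi h1).prodMk ((continuous_pi h2).prodMk
      ((continuous_pi fun i => continuous_pi (h3 i)).prodMk
        (continuous_pi fun i => continuous_pi (h4 i))))
  -- The endpoint `b + 1` is there because absolute continuity is given only on `[0, T]` with `T >
  -- 0`, while `b` may be `0`.
  have hmono : ∀ {a b : ℝ}, 0 ≤ a → a ≤ b → Set.uIcc a b ⊆ Set.uIcc 0 (b + 1) := by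
    intro a b ha hab
    rw [Set.uIcc_of_le hab, Set.uIcc_of_le (by linarith)]
    exact Set.Icc_subset_Icc ha (by linarith)
  refine ⟨hcont, fun t _ i k => ht.lam_nonneg i k _ (le_max_right _ _), ?_, ?_⟩
  · intro w hw a b ha hab
    rw [hxt a ha, hxt b (ha.trans hab)]
    have hb1 : 0 < b + 1 := by linarith
    refine AbsolutelyContinuousOnInterval.sub_le_integral
      (φ := fun t => D.lyap (fun i => z i t, fun i => ζ i t, fun i k => lam i k t,
        fun i l => nu i l t) w) hab ?_ ?_ ?_
    · refine AbsolutelyContinuousOnInterval.finset_sum _ fun i _ => ?_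
      have h1 := (((ht.ac_z i _ hb1).mono (hmono ha hab)).norm_sub_sq (w.1 i)).const_mul (1 / 2)
      have h2 := (((ht.ac_ζ i _ hb1).mono (hmono ha hab)).norm_sub_sq (w.2.1 i)).const_mul (1 / 2)
      have h3 := (AbsolutelyContinuousOnInterval.finset_sum Finset.univ fun k _ =>
        (((ht.ac_lam i k _ hb1).mono (hmono ha hab)).norm_sub_sq (w.2.2.1 i k))).const_mul
          (D.α / 2)
      have h4 := (AbsolutelyContinuousOnInterval.finset_sum Finset.univ fun l _ =>
        (((ht.ac_nu i l _ hb1).mono (hmono ha hab)).norm_sub_sq (w.2.2.2 i l))).const_mul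
          (D.α / 2)
      exact ((h1.add h2).add h3).add h4
    · have : Continuous fun t => D.drift (x t) w := by fun_prop
      exact this.intervalIntegrable _ _
    · filter_upwards [ht.deriv_z, ht.deriv_ζ, ht.deriv_lam, ht.deriv_nu] with t h1 h2 h3 h4 htm
      have ht0 : 0 < t := ha.trans_lt htm.1
      replace h1 := h1 ht0
      replace h2 := h2 ht0
      replace h3 := h3 ht0
      replace h4 := h4 ht0
      choose Γ hΓ hz using h1
      rw [hxt t ht0.le]
      refine ⟨_, HasDerivAt.fun_sum fun i _ => (((((hz i).sub_const (w.1 i)).norm_sq.const_mul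
        (1 / 2)).add (((h2 i).sub_const (w.2.1 i)).norm_sq.const_mul (1 / 2))).add
        ((HasDerivAt.fun_sum fun k _ => ((h3 i k).sub_const
          (w.2.2.1 i k)).norm_sq).const_mul (D.α / 2))).add
        ((HasDerivAt.fun_sum fun l _ => ((h4 i l).sub_const
          (w.2.2.2 i l)).norm_sq).const_mul (D.α / 2)), ?_⟩
      refine Finset.sum_le_sum fun i _ => ?_
      have hα := D.α_pos
      have hf : D.f i (z i t) + inner ℝ (∇ (D.f i) (z i t)) (w.1 i - z i t) ≤ D.f i (w.1 i) :=
        convexOn_gradient_le (D.f_convex i) (D.f_diff i _) _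
      have hg : ∑ k, lam i k t * D.g i k (z i t) +
          inner ℝ (∑ k, lam i k t • Γ i k) (w.1 i - z i t) ≤
            ∑ k, lam i k t * D.g i k (w.1 i) := by
        rw [sum_inner, ← Finset.sum_add_distrib]
        refine Finset.sum_le_sum fun k _ => ?_
        rw [real_inner_smul_left, ← mul_add]
        exact mul_le_mul_of_nonneg_left ((hΓ i k).le (D.g_convex i k) _)
          (ht.lam_nonneg i k t ht0.le)
      have hh : ∑ l, nu i l t * D.h i l (z i t) +
          inner ℝ (∑ l, nu i l t • ∇ (D.h i l) (z i t)) (w.1 i - z i t) =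
            ∑ l, nu i l t * D.h i l (w.1 i) := by
        rw [sum_inner, ← Finset.sum_add_distrib]
        refine Finset.sum_congr rfl fun l _ => ?_
        rw [real_inner_smul_left, affineMap_inner_gradient]
        ring
      have hl : ∑ k, (lam i k t - w.2.2.1 i k) * eta (lam i k t) (D.g i k (z i t)) ≤
          ∑ k, lam i k t * D.g i k (z i t) - ∑ k, w.2.2.1 i k * D.g i k (z i t) := by
        rw [← Finset.sum_sub_distrib]
        refine Finset.sum_le_sum fun k _ => ?_
        rw [← sub_mul]
        exact sub_mul_eta_le (hw i k)
      have hn : ∑ l, (nu i l t - w.2.2.2 i l) * D.h i l (z i t) =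
          ∑ l, nu i l t * D.h i l (z i t) - ∑ l, w.2.2.2 i l * D.h i l (z i t) := by
        rw [← Finset.sum_sub_distrib]
        exact Finset.sum_congr rfl fun l _ => by ring
      have hzi : ∀ v : E, inner ℝ v (w.1 i - z i t) = - inner ℝ v (z i t - w.1 i) := by
        intro v; rw [← inner_neg_right, neg_sub]
      rw [hzi] at hf hg hh
      simp only [Program.lagr, Program.lap, blockLap]
      simp only [inner_sub_left, inner_add_left, inner_neg_left, real_inner_smul_left,
        real_inner_comm _ (z i t - w.1 i), real_inner_comm _ (ζ i t - w.2.1 i), RCLike.inner_apply,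
        conj_trivial, ← Finset.mul_sum] at *
      simp only [mul_comm (eta _ _), mul_comm (D.h i _ _) (_ - _)] at *
      have e1 := mul_le_mul_of_nonneg_left hf hα.le
      have e2 := mul_le_mul_of_nonneg_left hg hα.le
      have e3 := mul_le_mul_of_nonneg_left hl hα.le
      have e4 := congrArg (D.α * ·) hh
      have e5 := congrArg (D.α * ·) hn
      linarith
  · intro i k a b ha hab
    have hb1 : 0 < b + 1 := by linarith
    rw [hxt a ha, hxt b (ha.trans hab)]
    refine AbsolutelyContinuousOnInterval.sub_le_integral (φ := lam i k) hab
      ((ht.ac_lam i k _ hb1).mono (hmono ha hab)) ?_ ?_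
    · have : Continuous fun t => max (D.g i k ((x t).1 i)) 0 := by fun_prop
      exact this.intervalIntegrable _ _
    · filter_upwards [ht.deriv_lam] with t h3 htm
      have ht0 : 0 < t := ha.trans_lt htm.1
      refine ⟨_, h3 ht0 i k, ?_⟩
      rw [hxt t ht0.le]
      exact eta_le_max _ _

end Basic

/-- Both sides have the same right derivative at `s`. Only later times enter, which suits relations
known on `[0, ∞)`. -/
theorem eq_of_integral_eq_mul {φ : ℝ → ℝ} (hφ : Continuous φ) {c s : ℝ}
    (h : ∀ b, s ≤ b → ∫ t in s..b, φ t = (b - s) * c) : φ s = c := by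
  have h1 : HasDerivWithinAt (fun b => ∫ t in s..b, φ t) (φ s) (Set.Ici s) s :=
    (intervalIntegral.integral_hasDerivAt_right (hφ.intervalIntegrable _ _)
      (hφ.stronglyMeasurableAtFilter _ _) hφ.continuousAt).hasDerivWithinAt
  have h2 : HasDerivWithinAt (fun b => (b - s) * c) c (Set.Ici s) s := by
    simpa using (((hasDerivAt_id s).sub_const s).mul_const c).hasDerivWithinAt
  exact (uniqueDiffWithinAt_Ici s).eq_deriv _ h1
    (h2.congr (fun b hb => h b hb) (h s le_rfl))

theorem integral_nonpos_of_nonpos_on {φ : ℝ → ℝ} {a b : ℝ} (hab : a ≤ b)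
    (h : ∀ t ∈ Set.Icc a b, φ t ≤ 0) : ∫ t in a..b, φ t ≤ 0 := by
  rw [← neg_nonneg, ← intervalIntegral.integral_neg]
  exact intervalIntegral.integral_nonneg hab fun t ht => neg_nonneg.2 (h t ht)

/-! ### Saddle points, Lyapunov estimates and limits of translates -/

section Limits

variable {V E : Type*} [Fintype V] [DecidableEq V] {M P : V → Type*} [∀ i, Fintype (M i)]
  [∀ i, Fintype (P i)] [NormedAddCommGroup E] [InnerProductSpace ℝ E] [FiniteDimensional ℝ E]
  (D : Program V E M P)

namespace Program

theorem lyap_nonneg (x w : State E M P) : 0 ≤ D.lyap x w := by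
  have := D.α_pos
  unfold lyap
  positivity

theorem lyap_self (x : State E M P) : D.lyap x x = 0 := by
  simp [lyap]

/-- States carry the sup metric. The constant adds `2`, for the blocks weighted by `1 / 2`, and `2 /
α`, for those weighted by `α / 2`, so that it serves all four. -/
theorem dist_le_sqrt_lyap (x w : State E M P) :
    dist x w ≤ √((2 + 2 / D.α) * D.lyap x w) := by
  have hα := D.α_pos
  set R := √((2 + 2 / D.α) * D.lyap x w)
  have hR : 0 ≤ R := Real.sqrt_nonneg _
  have hterm : ∀ i, 1 / 2 * ‖x.1 i - w.1 i‖ ^ 2 + 1 / 2 * ‖x.2.1 i - w.2.1 i‖ ^ 2 +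
      D.α / 2 * ∑ k, ‖x.2.2.1 i k - w.2.2.1 i k‖ ^ 2 +
      D.α / 2 * ∑ l, ‖x.2.2.2 i l - w.2.2.2 i l‖ ^ 2 ≤ D.lyap x w := fun i =>
    Finset.single_le_sum (f := fun i => 1 / 2 * ‖x.1 i - w.1 i‖ ^ 2 +
      1 / 2 * ‖x.2.1 i - w.2.1 i‖ ^ 2 + D.α / 2 * ∑ k, ‖x.2.2.1 i k - w.2.2.1 i k‖ ^ 2 +
      D.α / 2 * ∑ l, ‖x.2.2.2 i l - w.2.2.2 i l‖ ^ 2) (fun i _ => by positivity)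
      (Finset.mem_univ i)
  have hl := D.lyap_nonneg x w
  have hsq : ∀ u : ℝ, 1 / 2 * u ^ 2 ≤ D.lyap x w → u ≤ R := by
    intro u hu
    refine Real.le_sqrt_of_sq_le ?_
    have : 0 ≤ 2 / D.α * D.lyap x w := by positivity
    nlinarith
  have hsq' : ∀ u : ℝ, D.α / 2 * u ^ 2 ≤ D.lyap x w → u ≤ R := by
    intro u hu
    refine Real.le_sqrt_of_sq_le ?_
    have h1 : u ^ 2 ≤ 2 / D.α * D.lyap x w := by
      calc u ^ 2 = 2 / D.α * (D.α / 2 * u ^ 2) := by field_simp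
        _ ≤ _ := by gcongr
    nlinarith
  have p3 : ∀ i, 0 ≤ D.α / 2 * ∑ k, ‖x.2.2.1 i k - w.2.2.1 i k‖ ^ 2 := fun i => by positivity
  have p4 : ∀ i, 0 ≤ D.α / 2 * ∑ k, ‖x.2.2.2 i k - w.2.2.2 i k‖ ^ 2 := fun i => by positivity
  have p1 : ∀ i, 0 ≤ 1 / 2 * ‖x.1 i - w.1 i‖ ^ 2 := fun i => by positivity
  have p2 : ∀ i, 0 ≤ 1 / 2 * ‖x.2.1 i - w.2.1 i‖ ^ 2 := fun i => by positivity
  refine max_le ?_ (max_le ?_ (max_le ?_ ?_))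
  · refine (dist_pi_le_iff hR).2 fun i => hsq _ ?_
    rw [dist_eq_norm]
    linarith [hterm i, p1 i, p2 i, p3 i, p4 i]
  · refine (dist_pi_le_iff hR).2 fun i => hsq _ ?_
    rw [dist_eq_norm]
    linarith [hterm i, p1 i, p2 i, p3 i, p4 i]
  · refine (dist_pi_le_iff hR).2 fun i => (dist_pi_le_iff hR).2 fun k => hsq' _ ?_
    rw [dist_eq_norm]
    have := Finset.single_le_sum (f := fun k => ‖x.2.2.1 i k - w.2.2.1 i k‖ ^ 2)
      (fun k _ => by positivity) (Finset.mem_univ k)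
    have := mul_le_mul_of_nonneg_left this (half_pos hα).le
    linarith [hterm i, p1 i, p2 i, p3 i, p4 i]
  · refine (dist_pi_le_iff hR).2 fun i => (dist_pi_le_iff hR).2 fun k => hsq' _ ?_
    rw [dist_eq_norm]
    have := Finset.single_le_sum (f := fun k => ‖x.2.2.2 i k - w.2.2.2 i k‖ ^ 2)
      (fun k _ => by positivity) (Finset.mem_univ k)
    have := mul_le_mul_of_nonneg_left this (half_pos hα).le
    linarith [hterm i, p1 i, p2 i, p3 i, p4 i]

/-- The surplus of the local Lagrangian, tilted by the consensus multiplier, over the local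
optimal cost. -/
def gap (zs : E) (p : State E M P) (i : V) (w : E) : ℝ :=
  D.α * (D.lagr i w (p.2.2.1 i) (p.2.2.2 i) - D.f i zs) - inner ℝ (D.lap p.2.1 i) (w - zs)

/-- Saddle points of the Lagrangian with primal part `zs`. -/
structure IsSaddle (zs : E) (p : State E M P) : Prop where
  z_eq : ∀ i, p.1 i = zs
  nonneg : ∀ i k, 0 ≤ p.2.2.1 i k
  g_le : ∀ i k, D.g i k zs ≤ 0
  h_eq : ∀ i l, D.h i l zs = 0
  compl : ∀ i k, p.2.2.1 i k * D.g i k zs = 0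
  gap_nonneg : ∀ i w, 0 ≤ D.gap zs p i w

variable {D}

theorem lagr_eq_of_compl {zs : E} {i : V} {lam : M i → ℝ} (nu : P i → ℝ)
    (hh : ∀ l, D.h i l zs = 0) (hlam : ∀ k, lam k * D.g i k zs = 0) :
    D.lagr i zs lam nu = D.f i zs := by
  simp [lagr, hh, hlam]

variable {zs : E} {p : State E M P}

/-- Symmetry of the Laplacian cancels the `z`–`ζ` cross terms, and consensus vectors lie in its
kernel. What remains is the dissipation: Dirichlet energy, violation of complementarity, and local
gaps, each nonnegative on admissible states. -/
theorem IsSaddle.drift_eq (hp : D.IsSaddle zs p) (x : State E M P) :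
    D.drift x p = -(∑ i, inner ℝ (D.lap x.1 i) (x.1 i) +
      ∑ i, ∑ k, -(D.α * (x.2.2.1 i k * D.g i k zs)) + ∑ i, D.gap zs p i (x.1 i)) := by
  have e1 : ∑ i, inner ℝ (D.lap x.1 i) zs = (0 : ℝ) := sum_inner_blockLap_const D.G x.1 zs
  have e2 : ∑ i, inner ℝ (D.lap x.2.1 i) zs = (0 : ℝ) := sum_inner_blockLap_const D.G x.2.1 zs
  have e3 : ∑ i, inner ℝ (D.lap x.1 i) (x.2.1 i) = ∑ i, inner ℝ (D.lap x.2.1 i) (x.1 i) :=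
    sum_inner_blockLap_comm D.G _ _
  have e4 : ∑ i, inner ℝ (D.lap x.1 i) (p.2.1 i) = ∑ i, inner ℝ (D.lap p.2.1 i) (x.1 i) :=
    sum_inner_blockLap_comm D.G _ _
  have e5 : ∑ i, inner ℝ (D.lap p.2.1 i) zs = (0 : ℝ) := sum_inner_blockLap_const D.G p.2.1 zs
  have hl : ∀ i, D.lagr i zs (x.2.2.1 i) (x.2.2.2 i) =
      D.f i zs + ∑ k, x.2.2.1 i k * D.g i k zs := by
    intro i; simp [lagr, hp.h_eq]
  simp only [drift, gap, hp.z_eq, inner_sub_right, inner_add_left, inner_neg_left, hl, mul_sub,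
    mul_add, Finset.sum_add_distrib, Finset.sum_sub_distrib, Finset.sum_neg_distrib,
    Finset.mul_sum, e1, e2, e3, e4, e5]
  ring

theorem IsSaddle.drift_terms_nonneg (hp : D.IsSaddle zs p) {x : State E M P}
    (hx : ∀ i k, 0 ≤ x.2.2.1 i k) : (0 ≤ ∑ i, inner ℝ (D.lap x.1 i) (x.1 i)) ∧
      (∀ i k, 0 ≤ -(D.α * (x.2.2.1 i k * D.g i k zs))) ∧ ∀ i, 0 ≤ D.gap zs p i (x.1 i) := by
  refine ⟨sum_inner_blockLap_nonneg D.G x.1, fun i k => ?_, fun i => hp.gap_nonneg i _⟩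
  have := mul_nonneg (hx i k) (neg_nonneg.2 (hp.g_le i k))
  have := mul_nonneg D.α_pos.le this
  linarith

theorem IsSaddle.drift_nonpos (hp : D.IsSaddle zs p) {x : State E M P}
    (hx : ∀ i k, 0 ≤ x.2.2.1 i k) : D.drift x p ≤ 0 := by
  obtain ⟨h1, h2, h3⟩ := hp.drift_terms_nonneg hx
  rw [hp.drift_eq, neg_nonpos]
  have h4 := Finset.sum_nonneg fun i (_ : i ∈ Finset.univ) =>
    Finset.sum_nonneg fun k (_ : k ∈ Finset.univ) => h2 i k
  have h5 := Finset.sum_nonneg fun i (_ : i ∈ Finset.univ) => h3 i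
  linarith

theorem IsSaddle.of_drift_eq_zero (hp : D.IsSaddle zs p) {x : State E M P}
    (hx : ∀ i k, 0 ≤ x.2.2.1 i k) (h : D.drift x p = 0) :
    (∑ i, inner ℝ (D.lap x.1 i) (x.1 i) = 0) ∧
      (∀ i k, x.2.2.1 i k * D.g i k zs = 0) ∧ ∀ i, D.gap zs p i (x.1 i) = 0 := by
  obtain ⟨h1, h2, h3⟩ := hp.drift_terms_nonneg hx
  rw [hp.drift_eq, neg_eq_zero] at h
  have h2' := fun i => Finset.sum_nonneg fun k (_ : k ∈ Finset.univ) => h2 i k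
  have h4 := Finset.sum_nonneg fun i (_ : i ∈ Finset.univ) => h2' i
  have h5 := Finset.sum_nonneg fun i (_ : i ∈ Finset.univ) => h3 i
  refine ⟨by linarith, fun i k => ?_, fun i => ?_⟩
  · have e1 := (Finset.sum_eq_zero_iff_of_nonneg fun i _ => h2' i).1
      (by linarith) i (Finset.mem_univ i)
    have e2 := (Finset.sum_eq_zero_iff_of_nonneg fun k _ => h2 i k).1 e1 k (Finset.mem_univ k)
    simpa [D.α_pos.ne'] using e2
  · exact (Finset.sum_eq_zero_iff_of_nonneg fun i _ => h3 i).1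
      (by linarith) i (Finset.mem_univ i)

variable {x : ℝ → State E M P}

theorem IsWeakTrajectory.lyap_antitone (hx : D.IsWeakTrajectory x) (hp : D.IsSaddle zs p) :
    AntitoneOn (fun t => D.lyap (x t) p) (Set.Ici 0) := by
  intro a ha b _ hab
  have h1 := hx.lyap_le p hp.nonneg a b ha hab
  have h2 : ∫ t in a..b, D.drift (x t) p ≤ 0 := by
    refine integral_nonpos_of_nonpos_on hab fun t ht => ?_
    exact hp.drift_nonpos (hx.nonneg t (le_trans ha ht.1))
  simp only
  linarith

theorem IsWeakTrajectory.isBounded (hx : D.IsWeakTrajectory x) (hp : D.IsSaddle zs p)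
    (hx0 : ∀ t, x t = x (max t 0)) : Bornology.IsBounded (Set.range x) := by
  refine (Metric.isBounded_iff_subset_closedBall p).2
    ⟨√((2 + 2 / D.α) * D.lyap (x 0) p), ?_⟩
  rintro _ ⟨t, rfl⟩
  have hα := D.α_pos
  rw [Metric.mem_closedBall, hx0]
  refine (D.dist_le_sqrt_lyap _ _).trans (Real.sqrt_le_sqrt ?_)
  refine mul_le_mul_of_nonneg_left ?_ (by positivity)
  exact hx.lyap_antitone hp Set.self_mem_Ici (le_max_right t 0) (le_max_right t 0)

/-- No velocity bound is available for a weak trajectory. Testing with its own earlier state `x a`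
bounds the squared displacement by a multiple of `b - a`, which gives Hölder continuity of exponent
one half. -/
theorem IsWeakTrajectory.uniformContinuous (hx : D.IsWeakTrajectory x) (hp : D.IsSaddle zs p)
    (hx0 : ∀ t, x t = x (max t 0)) : UniformContinuous x := by
  have hα := D.α_pos
  have hK : IsCompact (closure (Set.range x)) := (hx.isBounded hp hx0).isCompact_closure
  obtain ⟨C, hC⟩ := (hK.prod hK).exists_bound_of_continuousOn D.continuous_drift.continuousOn
  have hd : ∀ s t, D.drift (x s) (x t) ≤ |C| := fun s t =>
    (le_abs_self _).trans ((hC (x s, x t) ⟨subset_closure (Set.mem_range_self _),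
      subset_closure (Set.mem_range_self _)⟩).trans (le_abs_self C))
  have key : ∀ a b, 0 ≤ a → a ≤ b →
      dist (x b) (x a) ≤ √((2 + 2 / D.α) * (|C| * (b - a))) := by
    intro a b ha hab
    refine (D.dist_le_sqrt_lyap _ _).trans (Real.sqrt_le_sqrt ?_)
    refine mul_le_mul_of_nonneg_left ?_ (by positivity)
    have h1 := hx.lyap_le (x a) (hx.nonneg a ha) a b ha hab
    rw [lyap_self, sub_zero] at h1
    have hc : Continuous fun t => D.drift (x t) (x a) := by
      have := hx.cont
      fun_prop
    have h2 := intervalIntegral.integral_mono_on hab (hc.intervalIntegrable a b)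
      (intervalIntegrable_const (μ := volume) (c := |C|)) fun t _ => hd t a
    rw [intervalIntegral.integral_const, smul_eq_mul] at h2
    linarith
  have key2 : ∀ a b, dist (x b) (x a) ≤ √((2 + 2 / D.α) * (|C| * |b - a|)) := by
    intro a b
    rw [hx0 a, hx0 b]
    have hm := abs_max_sub_max_le_abs b a 0
    rcases le_total (max a 0) (max b 0) with h | h
    · refine (key _ _ (le_max_right a 0) h).trans (Real.sqrt_le_sqrt ?_)
      gcongr
      exact (le_abs_self _).trans hm
    · rw [dist_comm]
      refine (key _ _ (le_max_right b 0) h).trans (Real.sqrt_le_sqrt ?_)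
      gcongr
      rw [abs_sub_comm] at hm
      exact (le_abs_self _).trans hm
  have hmod : Tendsto (fun r : ℝ => √((2 + 2 / D.α) * (|C| * r))) (𝓝 0) (𝓝 0) := by
    have : Continuous fun r : ℝ => √((2 + 2 / D.α) * (|C| * r)) := by fun_prop
    simpa using this.tendsto 0
  refine Metric.uniformContinuous_iff.2 fun ε hε => ?_
  obtain ⟨δ, hδ, hδ'⟩ := Metric.eventually_nhds_iff.1 (hmod.eventually (gt_mem_nhds hε))
  refine ⟨δ, hδ, fun {a b} hab => (key2 b a).trans_lt (hδ' ?_)⟩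
  rw [Real.dist_eq] at hab
  simpa using hab

theorem tendsto_integral_translates {X : Type*} [TopologicalSpace X] {x y : ℝ → X}
    {K : Set X} (hK : IsCompact K) (hxK : ∀ t, x t ∈ K) (hx : Continuous x) {τ : ℕ → ℝ}
    (hy : ∀ s, Tendsto (fun k => x (τ k + s)) atTop (𝓝 (y s))) {F : X → ℝ} (hF : Continuous F)
    (a b : ℝ) : Tendsto (fun k => ∫ t in (τ k + a)..(τ k + b), F (x t)) atTop
      (𝓝 (∫ s in a..b, F (y s))) := by
  obtain ⟨C, hC⟩ := hK.exists_bound_of_continuousOn hF.continuousOn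
  have h1 : ∀ k, ∫ t in (τ k + a)..(τ k + b), F (x t) = ∫ s in a..b, F (x (τ k + s)) := fun k =>
    (intervalIntegral.integral_comp_add_left (fun t => F (x t)) (τ k)).symm
  simp_rw [h1]
  refine intervalIntegral.tendsto_integral_filter_of_dominated_convergence (fun _ => C)
    (Eventually.of_forall fun k => ?_) (Eventually.of_forall fun k => ?_)
    intervalIntegrable_const ?_
  · exact Continuous.aestronglyMeasurable (by fun_prop)
  · exact Eventually.of_forall fun t _ => hC _ (hxK _)
  · exact Eventually.of_forall fun s _ => (hF.tendsto _).comp (hy s)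

/-- The defining inequalities involve only continuous functions of the state, so pointwise
convergence and dominated convergence preserve them. -/
theorem IsWeakTrajectory.exists_limit (hx : D.IsWeakTrajectory x) (hp : D.IsSaddle zs p)
    (hx0 : ∀ t, x t = x (max t 0)) {τ : ℕ → ℝ} (hτ : Tendsto τ atTop atTop) :
    ∃ φ : ℕ → ℕ, StrictMono φ ∧ ∃ y : ℝ → State E M P, D.IsWeakTrajectory y ∧
      ∀ s, Tendsto (fun k => x (τ (φ k) + s)) atTop (𝓝 (y s)) := by
  obtain ⟨φ, hφ, y, hyc, hy⟩ := exists_tendsto_translates (hx.uniformContinuous hp hx0)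
    (hx.isBounded hp hx0) τ
  have hK : IsCompact (closure (Set.range x)) := (hx.isBounded hp hx0).isCompact_closure
  have hxK : ∀ t, x t ∈ closure (Set.range x) := fun t => subset_closure (Set.mem_range_self t)
  have hτ' : ∀ᶠ k in atTop, 0 ≤ τ (φ k) := (hτ.comp hφ.tendsto_atTop).eventually_ge_atTop 0
  refine ⟨φ, hφ, y, ⟨hyc, ?_, ?_, ?_⟩, hy⟩
  · intro t ht i k
    have hc : Continuous fun q : State E M P => q.2.2.1 i k := by fun_prop
    refine ge_of_tendsto ((hc.tendsto _).comp (hy t)) ?_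
    filter_upwards [hτ'] with n hn
    exact hx.nonneg _ (by linarith) i k
  · intro w hw a b ha hab
    have hc : Continuous fun q : State E M P => D.lyap q w := by fun_prop
    refine le_of_tendsto_of_tendsto (((hc.tendsto _).comp (hy b)).sub
      ((hc.tendsto _).comp (hy a))) (tendsto_integral_translates hK hxK hx.cont hy
        (F := fun q => D.drift q w) (by fun_prop) a b) ?_
    filter_upwards [hτ'] with n hn
    exact hx.lyap_le w hw _ _ (by linarith) (by linarith)
  · intro i k a b ha hab
    have hc : Continuous fun q : State E M P => q.2.2.1 i k := by fun_prop
    refine le_of_tendsto_of_tendsto (((hc.tendsto _).comp (hy b)).sub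
      ((hc.tendsto _).comp (hy a))) (tendsto_integral_translates hK hxK hx.cont hy
        (F := fun q => max (D.g i k (q.1 i)) 0) (by fun_prop) a b) ?_
    filter_upwards [hτ'] with n hn
    exact hx.lam_le i k _ _ (by linarith) (by linarith)

/-- The distance to `p` is monotone and bounded below, hence convergent along `x`; a limit of
translates sees only its limiting value. -/
theorem IsWeakTrajectory.lyap_limit (hx : D.IsWeakTrajectory x) (hp : D.IsSaddle zs p)
    {τ : ℕ → ℝ} (hτ : Tendsto τ atTop atTop) {y : ℝ → State E M P}
    (hy : ∀ s, Tendsto (fun k => x (τ k + s)) atTop (𝓝 (y s))) (s s' : ℝ) :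
    D.lyap (y s) p = D.lyap (y s') p := by
  obtain ⟨ℓ, hℓ⟩ : ∃ ℓ, Tendsto (fun t => D.lyap (x t) p) atTop (𝓝 ℓ) := by
    have hanti : Antitone fun t => D.lyap (x (max t 0)) p := fun a b hab =>
      hx.lyap_antitone hp (le_max_right a 0) (le_max_right b 0) (max_le_max_right 0 hab)
    refine ⟨_, (tendsto_atTop_ciInf hanti ⟨0, ?_⟩).congr' ?_⟩
    · rintro _ ⟨t, rfl⟩
      exact D.lyap_nonneg _ _
    · filter_upwards [eventually_ge_atTop 0] with t ht
      rw [max_eq_left ht]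
  have key : ∀ s, D.lyap (y s) p = ℓ := by
    intro s
    have hc : Continuous fun q : State E M P => D.lyap q p := by fun_prop
    refine tendsto_nhds_unique ((hc.tendsto _).comp (hy s)) (hℓ.comp ?_)
    exact tendsto_atTop_add_const_right _ _ hτ
  rw [key, key]

/-- The drift is nonpositive, while constancy of the distance makes its integral nonnegative on
every interval. -/
theorem IsWeakTrajectory.drift_eq_zero {y : ℝ → State E M P} (hy : D.IsWeakTrajectory y)
    (hp : D.IsSaddle zs p) (hconst : ∀ s s', D.lyap (y s) p = D.lyap (y s') p) {s : ℝ}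
    (hs : 0 ≤ s) : D.drift (y s) p = 0 := by
  have hc : Continuous fun t => D.drift (y t) p := by
    have := hy.cont
    fun_prop
  refine eq_of_integral_eq_mul hc fun b hb => ?_
  rw [mul_zero]
  refine le_antisymm (integral_nonpos_of_nonpos_on hb fun t ht =>
    hp.drift_nonpos (hy.nonneg t (hs.trans ht.1))) ?_
  have := hy.lyap_le p hp.nonneg s b hs hb
  rw [hconst b s, sub_self] at this
  exact this

end Program

end Limits

/-! ### Equations of motion for limits at constant distance from a saddle point -/

section Stationary

variable {V E : Type*} [Fintype V] [DecidableEq V] {M P : V → Type*} [∀ i, Fintype (M i)]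
  [∀ i, Fintype (P i)] [NormedAddCommGroup E] [InnerProductSpace ℝ E] [FiniteDimensional ℝ E]
  {D : Program V E M P}

namespace Program

variable {zs : E} {p : State E M P} {y : ℝ → State E M P}

/-- Weak trajectories along which the distance to some saddle point is constant. -/
structure IsStationary (D : Program V E M P) (zs : E) (p : State E M P)
    (y : ℝ → State E M P) : Prop where
  weak : D.IsWeakTrajectory y
  saddle : D.IsSaddle zs p
  const : ∀ s s', D.lyap (y s) p = D.lyap (y s') p

theorem IsStationary.compl (hy : D.IsStationary zs p y) {s : ℝ} (hs : 0 ≤ s) (i : V) (k : M i) :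
    (y s).2.2.1 i k * D.g i k zs = 0 :=
  (hy.saddle.of_drift_eq_zero (hy.weak.nonneg s hs)
    (hy.weak.drift_eq_zero hy.saddle hy.const hs)).2.1 i k

theorem IsStationary.gap_eq_zero (hy : D.IsStationary zs p y) {s : ℝ} (hs : 0 ≤ s) (i : V) :
    D.gap zs p i ((y s).1 i) = 0 :=
  (hy.saddle.of_drift_eq_zero (hy.weak.nonneg s hs)
    (hy.weak.drift_eq_zero hy.saddle hy.const hs)).2.2 i

theorem IsStationary.consensus (hy : D.IsStationary zs p y) (hG : D.G.Connected) {s : ℝ}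
    (hs : 0 ≤ s) (i j : V) : (y s).1 i = (y s).1 j :=
  eq_of_sum_inner_blockLap_eq_zero hG (hy.saddle.of_drift_eq_zero (hy.weak.nonneg s hs)
    (hy.weak.drift_eq_zero hy.saddle hy.const hs)).1 i j

theorem lagr_add (i : V) (w : E) (lam lam' : M i → ℝ) (nu nu' : P i → ℝ) :
    D.lagr i w (lam + lam') (nu + nu') = D.lagr i w lam nu +
      (∑ k, lam' k * D.g i k w + ∑ l, nu' l * D.h i l w) := by
  simp only [lagr, Pi.add_apply, add_mul, Finset.sum_add_distrib]
  ring

/-- The variational inequality is tested at `p + d`, and the identity at `p`, where distance and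
drift contribute nothing, is subtracted. The quadratic terms cancel, leaving a left side linear in
`d`; consensus and complementarity simplify the right side. -/
theorem IsStationary.variation (hy : D.IsStationary zs p y) (hG : D.G.Connected)
    (d : State E M P) (hd : ∀ i k, 0 ≤ d.2.2.1 i k) {a b : ℝ} (ha : 0 ≤ a) (hab : a ≤ b) :
    -∑ i, (inner ℝ ((y b).1 i - (y a).1 i) (d.1 i) +
        inner ℝ ((y b).2.1 i - (y a).2.1 i) (d.2.1 i) +
        D.α * ∑ k, ((y b).2.2.1 i k - (y a).2.2.1 i k) * d.2.2.1 i k +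
        D.α * ∑ l, ((y b).2.2.2 i l - (y a).2.2.2 i l) * d.2.2.2 i l) ≤
      ∫ s in a..b, ∑ i, (-inner ℝ (D.lap (y s).2.1 i) (d.1 i) +
        D.α * (D.lagr i (zs + d.1 i) ((y s).2.2.1 i) ((y s).2.2.2 i) - D.f i zs) -
        D.α * (∑ k, d.2.2.1 i k * D.g i k ((y s).1 i) +
          ∑ l, d.2.2.2 i l * D.h i l ((y s).1 i))) := by
  have h1 := hy.weak.lyap_le (p + d) (fun i k => add_nonneg (hy.saddle.nonneg i k) (hd i k))
    a b ha hab
  have h2 : ∫ s in a..b, D.drift (y s) (p + d) = ∫ s in a..b, ∑ i,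
      (-inner ℝ (D.lap (y s).2.1 i) (d.1 i) +
        D.α * (D.lagr i (zs + d.1 i) ((y s).2.2.1 i) ((y s).2.2.2 i) - D.f i zs) -
        D.α * (∑ k, d.2.2.1 i k * D.g i k ((y s).1 i) +
          ∑ l, d.2.2.2 i l * D.h i l ((y s).1 i))) := by
    refine intervalIntegral.integral_congr fun s hs => ?_
    rw [Set.uIcc_of_le hab] at hs
    have hs0 : 0 ≤ s := ha.trans hs.1
    have h3 := hy.weak.drift_eq_zero hy.saddle hy.const hs0
    have h4 : ∀ i, D.lap (y s).1 i = 0 :=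
      blockLap_eq_zero D.G fun i j => hy.consensus hG hs0 i j
    have h5 : D.drift (y s) (p + d) = D.drift (y s) (p + d) - D.drift (y s) p := by
      rw [h3, sub_zero]
    rw [h5, drift, drift, ← Finset.sum_sub_distrib]
    refine Finset.sum_congr rfl fun i _ => ?_
    have h6 : D.lagr i zs ((y s).2.2.1 i) ((y s).2.2.2 i) = D.f i zs :=
      lagr_eq_of_compl _ (hy.saddle.h_eq i) fun k => hy.compl hs0 i k
    simp only [Prod.fst_add, Prod.snd_add, Pi.add_apply, h4, hy.saddle.z_eq, neg_zero, zero_add,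
      inner_zero_left, add_zero, lagr_add, h6, inner_sub_right, inner_add_right]
    ring
  have h7 : D.lyap (y b) (p + d) - D.lyap (y a) (p + d) =
      -∑ i, (inner ℝ ((y b).1 i - (y a).1 i) (d.1 i) +
        inner ℝ ((y b).2.1 i - (y a).2.1 i) (d.2.1 i) +
        D.α * ∑ k, ((y b).2.2.1 i k - (y a).2.2.1 i k) * d.2.2.1 i k +
        D.α * ∑ l, ((y b).2.2.2 i l - (y a).2.2.2 i l) * d.2.2.2 i l) := by
    have h8 : D.lyap (y b) (p + d) - D.lyap (y a) (p + d) = D.lyap (y b) (p + d) -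
        D.lyap (y a) (p + d) - (D.lyap (y b) p - D.lyap (y a) p) := by
      rw [hy.const b a, sub_self, sub_zero]
    have hE : ∀ u q e : E, ‖u - (q + e)‖ ^ 2 = ‖u - q‖ ^ 2 - 2 * inner ℝ u e +
        2 * inner ℝ q e + ‖e‖ ^ 2 := by
      intro u q e
      rw [← sub_sub, norm_sub_sq_real, inner_sub_left]
      ring
    have hR : ∀ u q e : ℝ, D.α / 2 * ‖u - (q + e)‖ ^ 2 = D.α / 2 * ‖u - q‖ ^ 2 -
        D.α * (u * e) + D.α * (q * e) + D.α / 2 * e ^ 2 := by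
      intro u q e
      simp only [Real.norm_eq_abs, sq_abs]
      ring
    rw [h8]
    simp only [lyap, ← Finset.sum_sub_distrib, ← Finset.sum_neg_distrib]
    refine Finset.sum_congr rfl fun i _ => ?_
    simp only [Prod.fst_add, Prod.snd_add, Pi.add_apply, hE, Finset.mul_sum, hR, sub_mul,
      inner_sub_left, Finset.sum_add_distrib, Finset.sum_sub_distrib, mul_sub, mul_add]
    ring
  rw [← h7, ← h2]
  exact h1

/-- Consensus annihilates the drive of `ζ`. Taking minus its displacement as test direction bounds
the squared displacement by zero. -/
theorem IsStationary.zeta_eq (hy : D.IsStationary zs p y) (hG : D.G.Connected) {s : ℝ}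
    (hs : 0 ≤ s) : (y s).2.1 = (y 0).2.1 := by
  have h := hy.variation hG (0, (y 0).2.1 - (y s).2.1, 0, 0) (fun i k => le_rfl) le_rfl hs
  have h0 : ∫ s in (0 : ℝ)..s, ∑ i, (-inner ℝ (D.lap (y s).2.1 i) (0 : E) +
        D.α * (D.lagr i (zs + 0) ((y s).2.2.1 i) ((y s).2.2.2 i) - D.f i zs) -
        D.α * (∑ k, 0 * D.g i k ((y s).1 i) + ∑ l, 0 * D.h i l ((y s).1 i))) = 0 := by
    refine (intervalIntegral.integral_congr (g := fun _ => (0 : ℝ)) fun t ht => ?_).trans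
      intervalIntegral.integral_zero
    rw [Set.uIcc_of_le hs] at ht
    refine Finset.sum_eq_zero fun i _ => ?_
    rw [add_zero, lagr_eq_of_compl _ (hy.saddle.h_eq i) fun k => hy.compl ht.1 i k]
    simp
  simp only [Pi.zero_apply, Pi.sub_apply] at h
  rw [h0] at h
  simp only [inner_zero_right, mul_zero, Finset.sum_const_zero, add_zero, zero_add] at h
  have h1 : ∑ i, ‖(y s).2.1 i - (y 0).2.1 i‖ ^ 2 ≤ 0 := by
    refine le_trans (le_of_eq ?_) h
    rw [← Finset.sum_neg_distrib]
    refine Finset.sum_congr rfl fun i _ => ?_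
    rw [← inner_neg_right, neg_sub, real_inner_self_eq_norm_sq]
  have h2 := (Finset.sum_eq_zero_iff_of_nonneg fun i _ => by positivity).1
    (le_antisymm h1 (Finset.sum_nonneg fun i _ => by positivity))
  ext1 i
  have h3 := h2 i (Finset.mem_univ i)
  exact sub_eq_zero.1 (norm_eq_zero.1 (pow_eq_zero_iff two_ne_zero |>.1 h3))

theorem IsStationary.z_variation (hy : D.IsStationary zs p y) (hG : D.G.Connected) (i : V) (e : E)
    {a b : ℝ} (ha : 0 ≤ a) (hab : a ≤ b) :
    -inner ℝ ((y b).1 i - (y a).1 i) e ≤ ∫ s in a..b, (-inner ℝ (D.lap (y 0).2.1 i) e +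
        D.α * (D.lagr i (zs + e) ((y s).2.2.1 i) ((y s).2.2.2 i) - D.f i zs)) := by
  have h := hy.variation hG (Pi.single i e, 0, 0, 0) (fun i k => le_rfl) ha hab
  convert h using 1
  · rw [Finset.sum_eq_single i]
    · simp
    · intro j _ hj; simp [hj]
    · simp
  · refine intervalIntegral.integral_congr fun s hs => ?_
    rw [Set.uIcc_of_le hab] at hs
    have hs0 : 0 ≤ s := ha.trans hs.1
    simp only
    rw [Finset.sum_eq_single i]
    · simp [hy.zeta_eq hG hs0]
    · intro j _ hj
      simp [hj, lagr_eq_of_compl _ (hy.saddle.h_eq j) fun k => hy.compl hs0 j k]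
    · simp

/-- Only nonnegative directions are admissible for these multipliers, so testing gives one
inequality. The upper bound comes from the field `lam_le` of weak trajectories. -/
theorem IsStationary.lam_ge (hy : D.IsStationary zs p y) (hG : D.G.Connected) (i : V) (k : M i)
    {a b : ℝ} (ha : 0 ≤ a) (hab : a ≤ b) :
    ∫ s in a..b, D.g i k ((y s).1 i) ≤ (y b).2.2.1 i k - (y a).2.2.1 i k := by
  classical
  have h := hy.variation hG (0, 0, Pi.single i (Pi.single k 1), 0) (fun j l => by
    have h1 : (0 : ∀ i, M i → ℝ) ≤ Pi.single i (Pi.single k 1) :=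
      Pi.single_nonneg.2 (Pi.single_nonneg.2 zero_le_one)
    exact h1 j l) ha hab
  have h2 : ∫ s in a..b, ∑ j, (-inner ℝ (D.lap (y s).2.1 j) ((0 : V → E) j) +
        D.α * (D.lagr j (zs + (0 : V → E) j) ((y s).2.2.1 j) ((y s).2.2.2 j) - D.f j zs) -
        D.α * (∑ l, (Pi.single i (Pi.single k 1) : ∀ i, M i → ℝ) j l * D.g j l ((y s).1 j) +
          ∑ l, (0 : ∀ i, P i → ℝ) j l * D.h j l ((y s).1 j))) =
      ∫ s in a..b, -(D.α * D.g i k ((y s).1 i)) := by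
    refine intervalIntegral.integral_congr fun s hs => ?_
    rw [Set.uIcc_of_le hab] at hs
    have hs0 : 0 ≤ s := ha.trans hs.1
    rw [Finset.sum_eq_single i]
    · rw [Finset.sum_eq_single k]
      · simp [lagr_eq_of_compl _ (hy.saddle.h_eq i) fun k => hy.compl hs0 i k]
      · intro l _ hl; simp [hl]
      · simp
    · intro j _ hj
      simp [hj, lagr_eq_of_compl _ (hy.saddle.h_eq j) fun k => hy.compl hs0 j k]
    · simp
  rw [h2, Finset.sum_eq_single i, Finset.sum_eq_single k] at h
  · simp only [Pi.zero_apply, inner_zero_right, Pi.single_eq_same, mul_one, mul_zero,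
      Finset.sum_const_zero, zero_add, add_zero, intervalIntegral.integral_neg,
      intervalIntegral.integral_const_mul, neg_le_neg_iff] at h
    exact le_of_mul_le_mul_left h D.α_pos
  · intro l _ hl; simp [hl]
  · simp
  · intro j _ hj; simp [hj]
  · simp

/-- The equality multipliers are unconstrained in sign, so testing with both `1` and `-1` gives
equality. -/
theorem IsStationary.nu_eq (hy : D.IsStationary zs p y) (hG : D.G.Connected) (i : V) (k : P i)
    {a b : ℝ} (ha : 0 ≤ a) (hab : a ≤ b) :
    (y b).2.2.2 i k - (y a).2.2.2 i k = ∫ s in a..b, D.h i k ((y s).1 i) := by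
  classical
  have key : ∀ c : ℝ, c * ∫ s in a..b, D.h i k ((y s).1 i) ≤
      ((y b).2.2.2 i k - (y a).2.2.2 i k) * c := by
    intro c
    have h := hy.variation hG (0, 0, 0, Pi.single i (Pi.single k c)) (fun j l => le_rfl) ha hab
    have h2 : ∫ s in a..b, ∑ j, (-inner ℝ (D.lap (y s).2.1 j) ((0 : V → E) j) +
          D.α * (D.lagr j (zs + (0 : V → E) j) ((y s).2.2.1 j) ((y s).2.2.2 j) - D.f j zs) -
          D.α * (∑ l, (0 : ∀ i, M i → ℝ) j l * D.g j l ((y s).1 j) +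
            ∑ l, (Pi.single i (Pi.single k c) : ∀ i, P i → ℝ) j l * D.h j l ((y s).1 j))) =
        ∫ s in a..b, -(D.α * (c * D.h i k ((y s).1 i))) := by
      refine intervalIntegral.integral_congr fun s hs => ?_
      rw [Set.uIcc_of_le hab] at hs
      have hs0 : 0 ≤ s := ha.trans hs.1
      rw [Finset.sum_eq_single i]
      · rw [Finset.sum_eq_single (s := (Finset.univ : Finset (P i))) k]
        · simp [lagr_eq_of_compl _ (hy.saddle.h_eq i) fun k => hy.compl hs0 i k]
        · intro l _ hl; simp [hl]
        · simp
      · intro j _ hj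
        simp [hj, lagr_eq_of_compl _ (hy.saddle.h_eq j) fun k => hy.compl hs0 j k]
      · simp
    rw [h2, Finset.sum_eq_single i,
      Finset.sum_eq_single (s := (Finset.univ : Finset (P i))) k] at h
    · simp only [Pi.zero_apply, inner_zero_right, Pi.single_eq_same, mul_zero,
        Finset.sum_const_zero, zero_add, add_zero, intervalIntegral.integral_neg,
        intervalIntegral.integral_const_mul, neg_le_neg_iff] at h
      exact le_of_mul_le_mul_left h D.α_pos
    · intro l _ hl; simp [hl]
    · simp
    · intro j _ hj; simp [hj]
    · simp
  have h1 := key 1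
  have h2 := key (-1)
  linarith

end Program

end Stationary

/-! ### Two rigidity lemmas for scalar functions -/

theorem eq_zero_of_forall_mul_le {K C : ℝ} (h : ∀ b : ℝ, 0 ≤ b → |b * K| ≤ C) : K = 0 := by
  by_contra hK
  have hK' : 0 < |K| := abs_pos.2 hK
  have hC : 0 ≤ C := (abs_nonneg _).trans (h 0 le_rfl)
  have := h ((C + 1) / |K|) (by positivity)
  rw [abs_mul, abs_of_nonneg (by positivity : 0 ≤ (C + 1) / |K|), div_mul_cancel₀ _ hK'.ne'] at this
  linarith

/-- While `σ` keeps a sign, all `u k` are monotone in the same direction, so a constant sum with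
strictly negative weights freezes each of them. At zeros of `σ` the increments are of smaller order
than time. Hence every right derivative vanishes. -/
theorem eq_of_sum_mul_eq {ι : Type*} [Fintype ι] {ψ : ι → ℝ → ℝ} {u : ι → ℝ → ℝ} {σ : ℝ → ℝ}
    {c : ι → ℝ} (hψ : ∀ k, Continuous (ψ k)) (hu : ∀ k, Continuous (u k)) (hσ : Continuous σ)
    (hψσ : ∀ k s, 0 ≤ s → ψ k s = 0 ∨ ψ k s = σ s) (hc : ∀ k, c k < 0)
    (hge : ∀ k a b, 0 ≤ a → a ≤ b → ∫ s in a..b, ψ k s ≤ u k b - u k a)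
    (hle : ∀ k a b, 0 ≤ a → a ≤ b → u k b - u k a ≤ ∫ s in a..b, max (ψ k s) 0)
    (hsum : ∀ s, 0 ≤ s → ∑ k, u k s * c k = ∑ k, u k 0 * c k) (k : ι) {s : ℝ} (hs : 0 ≤ s) :
    u k s = u k 0 := by
  have hdiff : ∀ a b, 0 ≤ a → a ≤ b → ∑ k, (u k b - u k a) * c k = 0 := by
    intro a b ha hab
    simp only [sub_mul, Finset.sum_sub_distrib]
    rw [hsum b (ha.trans hab), hsum a ha, sub_self]
  have hpos : ∀ a b, 0 ≤ a → a ≤ b → (∀ t ∈ Set.Icc a b, 0 ≤ σ t) → ∀ k, u k b = u k a := by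
    intro a b ha hab hσ k
    have h1 : ∀ k, 0 ≤ u k b - u k a := fun k =>
      (intervalIntegral.integral_nonneg hab fun t ht => by
        rcases hψσ k t (ha.trans ht.1) with h | h
        · exact h.ge
        · rw [h]; exact hσ t ht).trans (hge k a b ha hab)
    have h2 := (Finset.sum_eq_zero_iff_of_nonpos fun k _ =>
      mul_nonpos_of_nonneg_of_nonpos (h1 k) (hc k).le).1 (hdiff a b ha hab) k (Finset.mem_univ k)
    exact sub_eq_zero.1 ((mul_eq_zero.1 h2).resolve_right (hc k).ne)
  have hneg : ∀ a b, 0 ≤ a → a ≤ b → (∀ t ∈ Set.Icc a b, σ t ≤ 0) → ∀ k, u k b = u k a := by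
    intro a b ha hab hσ k
    have h1 : ∀ k, u k b - u k a ≤ 0 := fun k => (hle k a b ha hab).trans
      (integral_nonpos_of_nonpos_on hab fun t ht => max_le (by
        rcases hψσ k t (ha.trans ht.1) with h | h
        · exact h.le
        · rw [h]; exact hσ t ht) le_rfl)
    have h2 := (Finset.sum_eq_zero_iff_of_nonneg fun k _ =>
      mul_nonneg_of_nonpos_of_nonpos (h1 k) (hc k).le).1 (hdiff a b ha hab) k (Finset.mem_univ k)
    exact sub_eq_zero.1 ((mul_eq_zero.1 h2).resolve_right (hc k).ne)
  have hder : ∀ a, 0 ≤ a → HasDerivWithinAt (u k) 0 (Set.Ici a) a := by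
    intro a ha
    have hloc : ∀ S : Set ℝ, IsOpen S → σ a ∈ S → (∀ b, a ≤ b →
        (∀ t ∈ Set.Icc a b, σ t ∈ S) → u k b = u k a) →
        HasDerivWithinAt (u k) 0 (Set.Ici a) a := by
      intro S hS haS h
      obtain ⟨δ, hδ, hball⟩ := Metric.isOpen_iff.1 (hS.preimage hσ) a haS
      refine (hasDerivWithinAt_const a (Set.Ici a) (u k a)).congr_of_eventuallyEq ?_ rfl
      filter_upwards [self_mem_nhdsWithin, mem_nhdsWithin_of_mem_nhds (Metric.ball_mem_nhds a hδ)]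
        with b hb hb'
      refine h b hb fun t ht => hball ?_
      rw [Metric.mem_ball, Real.dist_eq, abs_of_nonneg (by linarith [ht.1])]
      rw [Metric.mem_ball, Real.dist_eq] at hb'
      linarith [le_abs_self (b - a), ht.2]
    rcases lt_trichotomy (σ a) 0 with h | h | h
    · exact hloc (Set.Iio 0) isOpen_Iio h fun b hb hm =>
        hneg a b ha hb (fun t ht => (hm t ht).le) k
    -- When `σ a = 0` the sign may oscillate just after `a`, but the increment of `u k` is at most
    -- `∫ |σ|` in absolute value, which is `o(b - a)`.
    · have h1 : HasDerivWithinAt (fun b => ∫ t in a..b, |σ t|) 0 (Set.Ici a) a := by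
        have := intervalIntegral.integral_hasDerivAt_right (hσ.abs.intervalIntegrable a a)
          (hσ.abs.stronglyMeasurableAtFilter _ _) hσ.abs.continuousAt
        rw [h, abs_zero] at this
        exact this.hasDerivWithinAt
      rw [hasDerivWithinAt_iff_isLittleO] at h1 ⊢
      refine Asymptotics.IsBigO.trans_isLittleO (Asymptotics.IsBigO.of_bound 1 ?_) h1
      filter_upwards [self_mem_nhdsWithin] with b hb
      have hab : a ≤ b := hb
      have e1 : ∫ t in a..b, max (ψ k t) 0 ≤ ∫ t in a..b, |σ t| :=
        intervalIntegral.integral_mono_on hab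
          (Continuous.intervalIntegrable ((hψ k).max continuous_const) _ _)
          (hσ.abs.intervalIntegrable _ _) fun t ht => max_le (by
            rcases hψσ k t (ha.trans ht.1) with h | h
            · rw [h]; positivity
            · rw [h]; exact le_abs_self _) (abs_nonneg _)
      have e2 : -∫ t in a..b, |σ t| ≤ ∫ t in a..b, ψ k t := by
        rw [← intervalIntegral.integral_neg]
        refine intervalIntegral.integral_mono_on hab
          (Continuous.intervalIntegrable hσ.abs.neg _ _)
          ((hψ k).intervalIntegrable _ _) fun t ht => ?_
        rcases hψσ k t (ha.trans ht.1) with h | h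
        · rw [h, neg_nonpos]; positivity
        · rw [h]; exact neg_abs_le _
      simp only [smul_zero, sub_zero, intervalIntegral.integral_same, one_mul]
      rw [Real.norm_eq_abs, Real.norm_eq_abs, abs_le]
      have e3 := le_abs_self (∫ t in a..b, |σ t|)
      have e4 := hle k a b ha hab
      have e5 := hge k a b ha hab
      constructor <;> linarith
    · exact hloc (Set.Ioi 0) isOpen_Ioi h fun b hb hm =>
        hpos a b ha hb (fun t ht => (hm t ht).le) k
  exact constant_of_has_deriv_right_zero (hu k).continuousOn (fun t ht => hder t ht.1) s
    ⟨hs, le_rfl⟩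

/-! ### From stationary limits to convergence; the differentiable case -/

section Convergence

variable {V E : Type*} [Fintype V] [DecidableEq V] {M P : V → Type*} [∀ i, Fintype (M i)]
  [∀ i, Fintype (P i)] [NormedAddCommGroup E] [InnerProductSpace ℝ E] [FiniteDimensional ℝ E]
  {D : Program V E M P}

namespace Program

variable {zs : E} {p : State E M P} {x y : ℝ → State E M P}

theorem IsStationary.dist_le (hy : D.IsStationary zs p y) (s : ℝ) :
    dist (y s) p ≤ √((2 + 2 / D.α) * D.lyap (y 0) p) := by
  rw [hy.const 0 s]
  exact D.dist_le_sqrt_lyap _ _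

/-- Once the estimates rest at `zs`, the multipliers rest too: equality residuals vanish, active
inequalities have value zero, and the other multipliers are zero by complementarity. The `z`
inequality then says that the gaps for `y 0` are nonnegative. -/
theorem IsStationary.isSaddle (hy : D.IsStationary zs p y) (hG : D.G.Connected)
    (hz : ∀ s ∈ Set.Icc (0 : ℝ) 1, ∀ i, (y s).1 i = zs) : D.IsSaddle zs (y 0) := by
  have h0 : (0 : ℝ) ∈ Set.Icc (0 : ℝ) 1 := ⟨le_rfl, zero_le_one⟩
  have hlam : ∀ s ∈ Set.Icc (0 : ℝ) 1, ∀ i k, (y s).2.2.1 i k = (y 0).2.2.1 i k := by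
    intro s hs i k
    have hc := hy.compl hs.1 i k
    have hc0 := hy.compl le_rfl i k
    by_cases hg : D.g i k zs = 0
    · have h1 := hy.lam_ge hG i k le_rfl hs.1
      have h2 := hy.weak.lam_le i k 0 s le_rfl hs.1
      have e1 : ∫ t in (0 : ℝ)..s, D.g i k ((y t).1 i) = 0 := by
        refine (intervalIntegral.integral_congr (g := fun _ => (0 : ℝ)) fun t ht => ?_).trans
          intervalIntegral.integral_zero
        rw [Set.uIcc_of_le hs.1] at ht
        simp only [hz t ⟨ht.1, ht.2.trans hs.2⟩, hg]
      have e2 : ∫ t in (0 : ℝ)..s, max (D.g i k ((y t).1 i)) 0 = 0 := by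
        refine (intervalIntegral.integral_congr (g := fun _ => (0 : ℝ)) fun t ht => ?_).trans
          intervalIntegral.integral_zero
        rw [Set.uIcc_of_le hs.1] at ht
        simp only [hz t ⟨ht.1, ht.2.trans hs.2⟩, hg, max_self]
      linarith
    · rw [(mul_eq_zero.1 hc).resolve_right hg, (mul_eq_zero.1 hc0).resolve_right hg]
  have hnu : ∀ s ∈ Set.Icc (0 : ℝ) 1, ∀ i l, (y s).2.2.2 i l = (y 0).2.2.2 i l := by
    intro s hs i l
    have h1 := hy.nu_eq hG i l le_rfl hs.1
    have e1 : ∫ t in (0 : ℝ)..s, D.h i l ((y t).1 i) = 0 := by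
      refine (intervalIntegral.integral_congr (g := fun _ => (0 : ℝ)) fun t ht => ?_).trans
        intervalIntegral.integral_zero
      rw [Set.uIcc_of_le hs.1] at ht
      simp only [hz t ⟨ht.1, ht.2.trans hs.2⟩, hy.saddle.h_eq i l]
    linarith
  refine ⟨hz 0 h0, hy.weak.nonneg 0 le_rfl, hy.saddle.g_le, hy.saddle.h_eq,
    fun i k => hy.compl le_rfl i k, fun i w => ?_⟩
  -- On an interval of length one the integral of the now constant integrand is the gap itself.
  have h := hy.z_variation hG i (w - zs) le_rfl zero_le_one
  have e : ∫ s in (0 : ℝ)..1, (-inner ℝ (D.lap (y 0).2.1 i) (w - zs) +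
      D.α * (D.lagr i (zs + (w - zs)) ((y s).2.2.1 i) ((y s).2.2.2 i) - D.f i zs)) =
      ∫ s in (0 : ℝ)..1, D.gap zs (y 0) i w := by
    refine intervalIntegral.integral_congr fun s hs => ?_
    rw [Set.uIcc_of_le zero_le_one] at hs
    have e1 : (y s).2.2.1 i = (y 0).2.2.1 i := funext fun k => hlam s hs i k
    have e2 : (y s).2.2.2 i = (y 0).2.2.2 i := funext fun l => hnu s hs i l
    simp only [e1, e2, add_sub_cancel, gap]
    ring
  rw [e, hz 0 h0, hz 1 ⟨zero_le_one, le_rfl⟩] at h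
  simpa using h

/-- The distance to a saddle point is nonincreasing, so once it is small along a subsequence it
stays small. -/
theorem IsWeakTrajectory.tendsto_of_limit_isSaddle (hx : D.IsWeakTrajectory x)
    {τ : ℕ → ℝ} (hτ : Tendsto τ atTop atTop) {q : State E M P} (hq : D.IsSaddle zs q)
    (hlim : Tendsto (fun k => x (τ k)) atTop (𝓝 q)) : Tendsto x atTop (𝓝 q) := by
  have hα := D.α_pos
  have hc : Continuous fun r : State E M P => √((2 + 2 / D.α) * D.lyap r q) := by
    have : Continuous fun r : State E M P => D.lyap r q := by fun_prop
    fun_prop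
  have h1 := (hc.tendsto q).comp hlim
  rw [lyap_self, mul_zero, Real.sqrt_zero] at h1
  refine Metric.tendsto_atTop.2 fun ε hε => ?_
  obtain ⟨k, hk1, hk2⟩ := ((h1.eventually (gt_mem_nhds hε)).and
    (hτ.eventually_ge_atTop 0)).exists
  refine ⟨τ k, fun t ht => (D.dist_le_sqrt_lyap _ _).trans_lt (lt_of_le_of_lt ?_ hk1)⟩
  refine Real.sqrt_le_sqrt (mul_le_mul_of_nonneg_left ?_ (by positivity))
  exact hx.lyap_antitone hq hk2 (le_trans hk2 ht) ht

/-- Along the line `zs + r • e` the slack `φ r` in the `z` inequality is nonnegative and vanishes at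
`r = 0`. Setting its derivative there to zero upgrades the inequality to an integrated differential
equation with gradients frozen at `zs`. -/
theorem IsStationary.inner_sub_eq (hy : D.IsStationary zs p y) (hG : D.G.Connected)
    (hdiff : ∀ i k, D.g i k zs = 0 → DifferentiableAt ℝ (D.g i k) zs) (i : V) (e : E)
    {a b : ℝ} (ha : 0 ≤ a) (hab : a ≤ b) :
    inner ℝ ((y b).1 i - (y a).1 i) e =
      (b - a) * (inner ℝ (D.lap (y 0).2.1 i) e - D.α * fderiv ℝ (D.f i) zs e) -
      D.α * ∑ k, (∫ s in a..b, (y s).2.2.1 i k) * fderiv ℝ (D.g i k) zs e -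
      D.α * ∑ l, (∫ s in a..b, (y s).2.2.2 i l) * (D.h i l).linear e := by
  have hyc := hy.weak.cont
  set φ : ℝ → ℝ := fun r => r * inner ℝ ((y b).1 i - (y a).1 i) e -
    r * ((b - a) * inner ℝ (D.lap (y 0).2.1 i) e) + (b - a) * (D.α * (D.f i (zs + r • e) -
      D.f i zs)) + D.α * ∑ k, (∫ s in a..b, (y s).2.2.1 i k) * D.g i k (zs + r • e) +
      D.α * ∑ l, (∫ s in a..b, (y s).2.2.2 i l) * D.h i l (zs + r • e) with hφ
  -- Inactive constraints may fail to be differentiable at `zs`, but their multipliers vanish along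
  -- `y`.
  have hlam : ∀ k, D.g i k zs ≠ 0 → ∫ s in a..b, (y s).2.2.1 i k = 0 := by
    intro k hk
    refine (intervalIntegral.integral_congr (g := fun _ => (0 : ℝ)) fun t ht => ?_).trans
      intervalIntegral.integral_zero
    rw [Set.uIcc_of_le hab] at ht
    exact (mul_eq_zero.1 (hy.compl (ha.trans ht.1) i k)).resolve_right hk
  have hφnn : ∀ r, 0 ≤ φ r := by
    intro r
    have h := hy.z_variation hG i (r • e) ha hab
    have hi : ∀ (i : V) (k : M i), IntervalIntegrable (fun s => (y s).2.2.1 i k) volume a b :=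
      fun i k => Continuous.intervalIntegrable (by fun_prop) _ _
    have hi' : ∀ (i : V) (l : P i), IntervalIntegrable (fun s => (y s).2.2.2 i l) volume a b :=
      fun i k => Continuous.intervalIntegrable (by fun_prop) _ _
    have e1 : ∫ s in a..b, (-inner ℝ (D.lap (y 0).2.1 i) (r • e) +
        D.α * (D.lagr i (zs + r • e) ((y s).2.2.1 i) ((y s).2.2.2 i) - D.f i zs)) =
        -(r * ((b - a) * inner ℝ (D.lap (y 0).2.1 i) e)) + (b - a) * (D.α * (D.f i (zs + r • e) -
        D.f i zs)) + D.α * ∑ k, (∫ s in a..b, (y s).2.2.1 i k) * D.g i k (zs + r • e) +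
        D.α * ∑ l, (∫ s in a..b, (y s).2.2.2 i l) * D.h i l (zs + r • e) := by
      have e2 : ∀ s, -inner ℝ (D.lap (y 0).2.1 i) (r • e) +
          D.α * (D.lagr i (zs + r • e) ((y s).2.2.1 i) ((y s).2.2.2 i) - D.f i zs) =
          ((-(r * inner ℝ (D.lap (y 0).2.1 i) e) + D.α * (D.f i (zs + r • e) - D.f i zs)) +
          D.α * ∑ k, (y s).2.2.1 i k * D.g i k (zs + r • e)) +
          D.α * ∑ l, (y s).2.2.2 i l * D.h i l (zs + r • e) := by
        intro s
        rw [lagr, real_inner_smul_right]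
        ring
      simp_rw [e2]
      rw [intervalIntegral.integral_add, intervalIntegral.integral_add,
        intervalIntegral.integral_const, intervalIntegral.integral_const_mul,
        intervalIntegral.integral_const_mul, intervalIntegral.integral_finsetSum,
        intervalIntegral.integral_finsetSum]
      · simp_rw [intervalIntegral.integral_mul_const]
        simp only [smul_eq_mul]
        ring
      · exact fun l _ => (hi' i l).mul_const _
      · exact fun k _ => (hi i k).mul_const _
      · exact intervalIntegrable_const
      · exact Continuous.intervalIntegrable (by fun_prop) _ _
      · exact Continuous.intervalIntegrable (by fun_prop) _ _
      · exact Continuous.intervalIntegrable (by fun_prop) _ _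
    rw [e1, real_inner_smul_right] at h
    simp only [hφ]
    linarith
  have hφ0 : φ 0 = 0 := by
    have h1 : ∑ k, (∫ s in a..b, (y s).2.2.1 i k) * D.g i k zs = 0 := by
      refine Finset.sum_eq_zero fun k _ => ?_
      by_cases hk : D.g i k zs = 0
      · rw [hk, mul_zero]
      · rw [hlam k hk, zero_mul]
    simp [hφ, h1, hy.saddle.h_eq]
  have hline : HasDerivAt (fun r : ℝ => zs + r • e) e 0 := by
    simpa using ((hasDerivAt_id (0 : ℝ)).smul_const e).const_add zs
  have hz : zs + (0 : ℝ) • e = zs := by simp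
  have hcomp : ∀ ψ : E → ℝ, DifferentiableAt ℝ ψ zs →
      HasDerivAt (fun r : ℝ => ψ (zs + r • e)) (fderiv ℝ ψ zs e) 0 := by
    intro ψ hψ
    have h1 : HasFDerivAt ψ (fderiv ℝ ψ zs) (zs + (0 : ℝ) • e) := by
      rw [hz]; exact hψ.hasFDerivAt
    exact h1.comp_hasDerivAt (0 : ℝ) hline
  have hgk : ∀ k, HasDerivAt (fun r : ℝ => (∫ s in a..b, (y s).2.2.1 i k) *
      D.g i k (zs + r • e)) ((∫ s in a..b, (y s).2.2.1 i k) * fderiv ℝ (D.g i k) zs e) 0 := by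
    intro k
    by_cases hk : D.g i k zs = 0
    · exact (hcomp _ (hdiff i k hk)).const_mul _
    · simp only [hlam k hk, zero_mul]
      exact hasDerivAt_const _ _
  have hhl : ∀ l, HasDerivAt (fun r : ℝ => (∫ s in a..b, (y s).2.2.2 i l) *
      D.h i l (zs + r • e)) ((∫ s in a..b, (y s).2.2.2 i l) * (D.h i l).linear e) 0 := by
    intro l
    have h1 : ∀ r : ℝ, D.h i l (zs + r • e) = r * (D.h i l).linear e + D.h i l zs := by
      intro r
      have := (D.h i l).map_vadd zs (r • e)
      rw [vadd_eq_add, vadd_eq_add, add_comm] at this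
      rw [this, map_smul, smul_eq_mul]
    simp_rw [h1]
    simpa using (((hasDerivAt_id (0 : ℝ)).mul_const ((D.h i l).linear e)).add_const
      (D.h i l zs)).const_mul (∫ s in a..b, (y s).2.2.2 i l)
  have hφd : HasDerivAt φ (1 * inner ℝ ((y b).1 i - (y a).1 i) e -
      1 * ((b - a) * inner ℝ (D.lap (y 0).2.1 i) e) +
      (b - a) * (D.α * fderiv ℝ (D.f i) zs e) +
      D.α * ∑ k, (∫ s in a..b, (y s).2.2.1 i k) * fderiv ℝ (D.g i k) zs e +
      D.α * ∑ l, (∫ s in a..b, (y s).2.2.2 i l) * (D.h i l).linear e) 0 := by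
    exact ((((((hasDerivAt_id (0 : ℝ)).mul_const _).sub ((hasDerivAt_id (0 : ℝ)).mul_const _)).add
      ((((hcomp _ (D.f_diff i zs)).sub_const _).const_mul _).const_mul _)).add
      ((HasDerivAt.fun_sum fun k _ => hgk k).const_mul _))).add
      ((HasDerivAt.fun_sum fun l _ => hhl l).const_mul _)
  have hmin : IsLocalMin φ 0 := Eventually.of_forall fun r => by rw [hφ0]; exact hφnn r
  have := hmin.hasDerivAt_eq_zero hφd
  linarith

/-- The Slater direction freezes the inequality multipliers; then the motion is linear in time in
the directions of `hspan`, and boundedness stops it. A constant nonzero equality residual would make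
`ν` grow without bound. -/
theorem IsStationary.const_of_differentiable (hy : D.IsStationary zs p y) (hG : D.G.Connected)
    (hdiff : ∀ i k, D.g i k zs = 0 → DifferentiableAt ℝ (D.g i k) zs) {zS : E}
    (hSg : ∀ i k, D.g i k zS < 0) (hSh : ∀ i l, D.h i l zS = 0)
    (hm : ∀ s, 0 ≤ s → ∀ i, inner ℝ ((y s).1 i - zs) (zS - zs) = (0 : ℝ))
    {σ : ℝ → ℝ} (hσ : Continuous σ) (hact : ∀ i k, D.g i k zs = 0 → ∀ s, 0 ≤ s →
      D.g i k ((y s).1 i) = 0 ∨ D.g i k ((y s).1 i) = σ s)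
    (hspan : ∀ v : E, (∀ i e, (∀ l, (D.h i l).linear e = 0) → inner ℝ v e = (0 : ℝ)) → v = 0)
    {s : ℝ} (hs : 0 ≤ s) (i : V) :
    (y s).1 i = (y 0).1 i ∧ ∀ l, D.h i l ((y 0).1 i) = 0 := by
  have hα := D.α_pos
  have hyc := hy.weak.cont
  have hi : ∀ (i : V) (k : M i) a b, IntervalIntegrable (fun s => (y s).2.2.1 i k) volume a b :=
    fun i k a b => Continuous.intervalIntegrable (by fun_prop) _ _
  have hlam0 : ∀ i k, D.g i k zs ≠ 0 → ∀ s, 0 ≤ s → (y s).2.2.1 i k = 0 := fun i k hk s hs =>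
    (mul_eq_zero.1 (hy.compl hs i k)).resolve_right hk
  -- In the direction `zS - zs` neither the estimate nor the equalities contribute, so the weighted
  -- multiplier sum equals a time-independent constant `C`.
  have hsum : ∀ i s, 0 ≤ s → ∑ k, (y s).2.2.1 i k * fderiv ℝ (D.g i k) zs (zS - zs) =
      ∑ k, (y 0).2.2.1 i k * fderiv ℝ (D.g i k) zs (zS - zs) := by
    intro i
    set C := (inner ℝ (D.lap (y 0).2.1 i) (zS - zs) -
      D.α * fderiv ℝ (D.f i) zs (zS - zs)) / D.α with hC
    have key : ∀ s, 0 ≤ s → ∑ k, (y s).2.2.1 i k * fderiv ℝ (D.g i k) zs (zS - zs) = C := by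
      intro s hs
      refine eq_of_integral_eq_mul (φ := fun s => ∑ k, (y s).2.2.1 i k *
        fderiv ℝ (D.g i k) zs (zS - zs)) (by fun_prop) fun b hb => ?_
      have h1 := hy.inner_sub_eq hG hdiff i (zS - zs) hs hb
      have h2 : ∀ l, (D.h i l).linear (zS - zs) = 0 := by
        intro l
        have := (D.h i l).linearMap_vsub zS zs
        rw [vsub_eq_sub, vsub_eq_sub, hSh, hy.saddle.h_eq, sub_zero] at this
        exact this
      have h3 : inner ℝ ((y b).1 i - (y s).1 i) (zS - zs) = (0 : ℝ) := by
        rw [← sub_sub_sub_cancel_right _ _ zs, inner_sub_left, hm b (hs.trans hb), hm s hs,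
          sub_zero]
      rw [intervalIntegral.integral_finsetSum fun k _ => (hi i k s b).mul_const _]
      simp_rw [intervalIntegral.integral_mul_const]
      simp only [h2, h3, mul_zero, Finset.sum_const_zero, sub_zero] at h1
      rw [hC]
      field_simp
      linarith
    intro s hs
    rw [key s hs, key 0 le_rfl]
  have hlam : ∀ i k s, 0 ≤ s → (y s).2.2.1 i k = (y 0).2.2.1 i k := by
    intro i k s hs
    by_cases hk : D.g i k zs = 0
    swap
    · rw [hlam0 i k hk s hs, hlam0 i k hk 0 le_rfl]
    classical
    have hact' : ∀ s, 0 ≤ s → ∑ k : {k // D.g i k zs = 0}, (y s).2.2.1 i k *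
        fderiv ℝ (D.g i k) zs (zS - zs) = ∑ k, (y s).2.2.1 i k *
        fderiv ℝ (D.g i k) zs (zS - zs) := by
      intro s hs
      rw [← Finset.sum_subtype (Finset.univ.filter fun k => D.g i k zs = 0) (by simp)
        (fun k => (y s).2.2.1 i k * fderiv ℝ (D.g i k) zs (zS - zs))]
      refine Finset.sum_subset (Finset.subset_univ _) fun k _ hk => ?_
      rw [hlam0 i k (by simpa using hk) s hs, zero_mul]
    refine eq_of_sum_mul_eq (ι := {k // D.g i k zs = 0})
      (ψ := fun k s => D.g i k ((y s).1 i)) (u := fun k s => (y s).2.2.1 i k)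
      (c := fun k => fderiv ℝ (D.g i k) zs (zS - zs)) (σ := σ) (fun k => by fun_prop)
      (fun k => by fun_prop) hσ (fun k s hs => hact i k k.2 s hs) (fun k => ?_)
      (fun k a b ha hab => hy.lam_ge hG i k ha hab)
      (fun k a b ha hab => hy.weak.lam_le i k a b ha hab)
      (fun s hs => by rw [hact' s hs, hact' 0 le_rfl, hsum i s hs]) ⟨k, hk⟩ hs
    have h1 := convexOn_gradient_le (D.g_convex i k) (hdiff i k k.2) zS
    rw [gradient, InnerProductSpace.toDual_symm_apply, k.2, zero_add] at h1
    exact h1.trans_lt (hSg i k)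
  have hdist : ∀ s i, ‖(y s).1 i - (y 0).1 i‖ ≤ 2 * √((2 + 2 / D.α) * D.lyap (y 0) p) := by
    intro s i
    rw [← dist_eq_norm]
    have h1 : dist ((y s).1 i) ((y 0).1 i) ≤ dist (y s) (y 0) :=
      (dist_le_pi_dist (y s).1 (y 0).1 i).trans (le_max_left _ _)
    have h2 := dist_triangle_right (y s) (y 0) p
    linarith [hy.dist_le s, hy.dist_le 0]
  have hz : ∀ s, 0 ≤ s → ∀ i, (y s).1 i = (y 0).1 i := by
    intro s hs i
    refine sub_eq_zero.1 (hspan _ fun j e he => ?_)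
    rw [hy.consensus hG hs i j, hy.consensus hG le_rfl i j]
    -- `K` is the constant velocity in direction `e`: agent `j`'s equality multipliers drop out
    -- because `e` lies in the kernel of its linear parts.
    set K := (inner ℝ (D.lap (y 0).2.1 j) e - D.α * fderiv ℝ (D.f j) zs e) -
      D.α * ∑ k, (y 0).2.2.1 j k * fderiv ℝ (D.g j k) zs e with hK
    have key : ∀ b, 0 ≤ b → inner ℝ ((y b).1 j - (y 0).1 j) e = b * K := by
      intro b hb
      rw [hy.inner_sub_eq hG hdiff j e le_rfl hb]
      have h1 : ∀ k, ∫ s in (0 : ℝ)..b, (y s).2.2.1 j k = b * (y 0).2.2.1 j k := by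
        intro k
        rw [intervalIntegral.integral_congr (g := fun _ => (y 0).2.2.1 j k) fun t ht => ?_]
        · simp
        · rw [Set.uIcc_of_le hb] at ht
          exact hlam j k t ht.1
      simp only [h1, he, mul_zero, Finset.sum_const_zero, sub_zero, hK, mul_assoc,
        ← Finset.mul_sum]
      ring
    have hK0 : K = 0 := by
      refine eq_zero_of_forall_mul_le
        (C := 2 * √((2 + 2 / D.α) * D.lyap (y 0) p) * ‖e‖) fun b hb => ?_
      rw [← key b hb]
      exact (abs_real_inner_le_norm _ _).trans
        (mul_le_mul_of_nonneg_right (hdist b j) (norm_nonneg e))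
    rw [key s hs, hK0, mul_zero]
  refine ⟨hz s hs i, fun l => ?_⟩
  refine eq_zero_of_forall_mul_le (C := 2 * √((2 + 2 / D.α) * D.lyap (y 0) p)) fun b hb => ?_
  have h1 := hy.nu_eq hG i l le_rfl hb
  rw [intervalIntegral.integral_congr (g := fun _ => D.h i l ((y 0).1 i)) fun t ht => ?_,
    intervalIntegral.integral_const, sub_zero, smul_eq_mul] at h1
  · rw [← h1, ← Real.dist_eq]
    have h2 := (dist_le_pi_dist ((y b).2.2.2 i) ((y 0).2.2.2 i) l).trans
      (dist_le_pi_dist (y b).2.2.2 (y 0).2.2.2 i)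
    have h3 : dist (y b).2.2.2 (y 0).2.2.2 ≤ dist (y b) (y 0) :=
      (le_max_right _ _).trans ((le_max_right _ _).trans (le_max_right _ _))
    have h4 := dist_triangle_right (y b) (y 0) p
    linarith [hy.dist_le b, hy.dist_le 0]
  · rw [Set.uIcc_of_le hb] at ht
    simp only [hz t ht.1 i]

end Program

end Convergence

/-! ### Existence of saddle points -/

theorem nonneg_of_forall_le_add_mul {A B c : ℝ} (h : ∀ t : ℝ, 0 ≤ t → B ≤ A + t * c) : 0 ≤ c := by
  by_contra! hc
  have h1 := h ((|A - B| + 1) / (-c)) (div_nonneg (by positivity) (by linarith))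
  have h2 : (|A - B| + 1) / (-c) * c = -(|A - B| + 1) := by
    rw [div_neg, neg_mul, div_mul_cancel₀ _ hc.ne]
  linarith [le_abs_self (A - B)]

/-- Strong duality by separating the point `(T x₀, 0, 0)` from the image of the strict epigraph.
Slater's condition prevents the weight `c₀` of the objective from vanishing. -/
theorem exists_multipliers {X Y K : Type*} [NormedAddCommGroup X] [NormedSpace ℝ X]
    [FiniteDimensional ℝ X] [NormedAddCommGroup Y] [NormedSpace ℝ Y] [FiniteDimensional ℝ Y]
    [Fintype K] (T : X →ₗ[ℝ] Y) {Φ : X → ℝ} {Γ : K → X → ℝ} (hΦ : ConvexOn ℝ Set.univ Φ)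
    (hΦc : Continuous Φ) (hΓ : ∀ k, ConvexOn ℝ Set.univ (Γ k)) (hΓc : ∀ k, Continuous (Γ k))
    {x₀ xS : X} (hopt : ∀ x, T x = T x₀ → (∀ k, Γ k x ≤ 0) → Φ x₀ ≤ Φ x)
    (hST : T xS = T x₀) (hS : ∀ k, Γ k xS < 0) :
    ∃ (c : K → ℝ) (μ : Y →ₗ[ℝ] ℝ), (∀ k, 0 ≤ c k) ∧
      ∀ x, Φ x₀ ≤ Φ x + ∑ k, c k * Γ k x + μ (T (x - x₀)) := by
  classical
  -- Restricting to the range of `T` makes `L` surjective, hence open, although the equality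
  -- constraints may be redundant.
  let L : X × ℝ × (K → ℝ) →ₗ[ℝ] T.range × ℝ × (K → ℝ) :=
    T.rangeRestrict.prodMap LinearMap.id
  let U : Set (X × ℝ × (K → ℝ)) := {q | Φ q.1 - Φ x₀ < q.2.1 ∧ ∀ k, Γ k q.1 < q.2.2 k}
  have hLs : Function.Surjective L :=
    Function.Surjective.prodMap T.surjective_rangeRestrict Function.surjective_id
  have hUo : IsOpen U := by
    refine IsOpen.and (isOpen_lt (by fun_prop) (by fun_prop)) ?_
    simp only [Set.ofPred_forall]
    exact isOpen_iInter_of_finite fun k => isOpen_lt (by fun_prop) (by fun_prop)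
  have hUc : Convex ℝ U := by
    intro q hq q' hq' a b ha hb hab
    refine ⟨?_, fun k => ?_⟩
    · have h1 := hΦ.2 (Set.mem_univ q.1) (Set.mem_univ q'.1) ha hb hab
      have h2 := hq.1
      have h3 := hq'.1
      simp only [Prod.fst_add, Prod.snd_add, Prod.smul_fst, Prod.smul_snd, smul_eq_mul] at *
      have h4 : Φ x₀ = a * Φ x₀ + b * Φ x₀ := by rw [← add_mul, hab, one_mul]
      rcases ha.eq_or_lt with rfl | ha'
      · have : b = 1 := by linarith
        subst this
        linarith
      · nlinarith
    · have h1 := (hΓ k).2 (Set.mem_univ q.1) (Set.mem_univ q'.1) ha hb hab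
      have h2 := hq.2 k
      have h3 := hq'.2 k
      simp only [Prod.fst_add, Prod.snd_add, Prod.smul_fst, Prod.smul_snd, smul_eq_mul,
        Pi.add_apply, Pi.smul_apply] at *
      rcases ha.eq_or_lt with rfl | ha'
      · have : b = 1 := by linarith
        subst this
        linarith
      · nlinarith
  have hCo : IsOpen (L '' U) := (L.isOpenMap_of_finiteDimensional hLs) U hUo
  have hCc : Convex ℝ (L '' U) := hUc.linear_image L
  have hx0 : (T.rangeRestrict x₀, (0 : ℝ), (0 : K → ℝ)) ∉ L '' U := by
    rintro ⟨q, hq, hLq⟩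
    have h1 : T.rangeRestrict q.1 = T.rangeRestrict x₀ := congrArg Prod.fst hLq
    have h2 : q.2.1 = 0 := congrArg (fun r => r.2.1) hLq
    have h3 : q.2.2 = 0 := congrArg (fun r => r.2.2) hLq
    have h4 := hopt q.1 (congrArg Subtype.val h1) fun k => by
      have := hq.2 k
      rw [h3] at this
      exact this.le
    have h5 := hq.1
    rw [h2] at h5
    linarith
  obtain ⟨F, hF⟩ := geometric_hahn_banach_point_open hCc hCo hx0
  set F1 : T.range →ₗ[ℝ] ℝ := F.toLinearMap ∘ₗ LinearMap.inl ℝ _ _ with hF1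
  set c₀ : ℝ := F (0, 1, 0) with hc0
  set d : K → ℝ := fun k => F (0, 0, Pi.single k 1) with hd
  have hFeq : ∀ r a b, F (r, a, b) = F1 r + a * c₀ + ∑ k, b k * d k := by
    intro r a b
    have h1 : (r, a, b) = ((r, 0, 0) : T.range × ℝ × (K → ℝ)) + a • (0, 1, 0) +
        ∑ k, b k • ((0, 0, Pi.single k 1) : T.range × ℝ × (K → ℝ)) := by
      refine Prod.ext ?_ (Prod.ext ?_ ?_)
      · simp [Prod.fst_sum]
      · simp [Prod.fst_sum, Prod.snd_sum]
      · ext k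
        simp [Prod.snd_sum, Finset.sum_apply, Pi.single_apply]
    rw [h1, map_add, map_add, map_smul, map_sum]
    simp only [map_smul, smul_eq_mul]
    rfl
  have hU : ∀ (x : X) (a : ℝ) (b : K → ℝ), Φ x - Φ x₀ < a → (∀ k, Γ k x < b k) →
      F1 (T.rangeRestrict x₀) < F1 (T.rangeRestrict x) + a * c₀ + ∑ k, b k * d k := by
    intro x a b ha hb
    have h1 := hF (L (x, a, b)) ⟨(x, a, b), ⟨ha, hb⟩, rfl⟩
    have h2 : L (x, a, b) = (T.rangeRestrict x, a, b) := rfl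
    rw [h2, hFeq, hFeq] at h1
    simpa using h1
  have hc0nn : 0 ≤ c₀ := by
    refine nonneg_of_forall_le_add_mul (B := F1 (T.rangeRestrict x₀))
      (A := F1 (T.rangeRestrict x₀) + 1 * c₀ + ∑ k, (Γ k x₀ + 1) * d k) fun t ht => ?_
    have := hU x₀ (1 + t) (fun k => Γ k x₀ + 1) (by linarith) fun k => by linarith
    linarith
  have hdnn : ∀ k, 0 ≤ d k := by
    intro k
    refine nonneg_of_forall_le_add_mul (B := F1 (T.rangeRestrict x₀))
      (A := F1 (T.rangeRestrict x₀) + 1 * c₀ + ∑ k, (Γ k x₀ + 1) * d k) fun t ht => ?_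
    have h1 := hU x₀ 1 (fun j => Γ j x₀ + 1 + if j = k then t else 0) (by linarith) fun j => by
      split_ifs <;> linarith
    have h2 : ∑ j, (Γ j x₀ + 1 + if j = k then t else 0) * d j =
        ∑ j, (Γ j x₀ + 1) * d j + t * d k := by
      simp [add_mul _ (ite _ _ _), Finset.sum_add_distrib]
    rw [h2] at h1
    linarith
  have hmain : ∀ x, 0 ≤ F1 (T.rangeRestrict (x - x₀)) + (Φ x - Φ x₀) * c₀ +
      ∑ k, Γ k x * d k := by
    intro x
    refine le_of_forall_pos_lt_add fun ε hε => ?_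
    -- Strict epigraph points need a margin. Sharing `ε / (S + 1)` among all coordinates costs at
    -- most `ε` in total.
    set S := c₀ + ∑ k, d k with hS
    have hSnn : 0 ≤ S := add_nonneg hc0nn (Finset.sum_nonneg fun k _ => hdnn k)
    have h1 := hU x (Φ x - Φ x₀ + ε / (S + 1)) (fun k => Γ k x + ε / (S + 1))
      (by linarith [show 0 < ε / (S + 1) by positivity])
      fun k => by linarith [show 0 < ε / (S + 1) by positivity]
    have h2 : ε / (S + 1) * S ≤ ε := by
      rw [div_mul_eq_mul_div, div_le_iff₀ (by positivity)]
      nlinarith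
    simp only [add_mul, Finset.sum_add_distrib, ← Finset.mul_sum] at h1
    rw [map_sub, map_sub]
    rw [hS, mul_add] at h2
    linarith
  -- If `c₀ = 0`, evaluation at the Slater point kills every `d k`, contradicting strict separation
  -- at `x₀` itself.
  have hc0pos : 0 < c₀ := by
    refine lt_of_le_of_ne hc0nn fun h0 => ?_
    have h1 := hmain xS
    have h2 : T.rangeRestrict (xS - x₀) = 0 := by
      ext
      simp [hST]
    rw [h2, map_zero, ← h0, mul_zero, zero_add, zero_add] at h1
    have h3 : ∀ k, Γ k xS * d k ≤ 0 := fun k =>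
      mul_nonpos_of_nonpos_of_nonneg (hS k).le (hdnn k)
    have h4 : ∀ k, d k = 0 := fun k => (mul_eq_zero.1
      ((Finset.sum_eq_zero_iff_of_nonpos fun k _ => h3 k).1
        (le_antisymm (Finset.sum_nonpos fun k _ => h3 k) h1) k
          (Finset.mem_univ k))).resolve_left (hS k).ne
    have h5 := hU x₀ 1 (fun k => Γ k x₀ + 1) (by linarith) fun k => by linarith
    simp [h4, ← h0] at h5
  obtain ⟨μ, hμ⟩ := LinearMap.exists_extend F1
  refine ⟨fun k => d k / c₀, c₀⁻¹ • μ, fun k => div_nonneg (hdnn k) hc0pos.le, fun x => ?_⟩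
  have h1 : μ (T (x - x₀)) = F1 (T.rangeRestrict (x - x₀)) := by
    rw [← hμ]; rfl
  have h2 := hmain x
  rw [LinearMap.smul_apply, h1, smul_eq_mul]
  have h3 : ∑ k, d k / c₀ * Γ k x = c₀⁻¹ * ∑ k, Γ k x * d k := by
    rw [Finset.mul_sum]
    exact Finset.sum_congr rfl fun k _ => by field_simp
  rw [h3]
  have h4 : 0 ≤ c₀⁻¹ * (F1 (T.rangeRestrict (x - x₀)) + (Φ x - Φ x₀) * c₀ +
      ∑ k, Γ k x * d k) := mul_nonneg (inv_nonneg.2 hc0pos.le) h2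
  have h5 : c₀⁻¹ * ((Φ x - Φ x₀) * c₀) = Φ x - Φ x₀ := by field_simp
  rw [mul_add, mul_add, h5] at h4
  linarith

section Saddle

variable {V E : Type*} [Fintype V] [DecidableEq V] {M P : V → Type*} [∀ i, Fintype (M i)]
  [∀ i, Fintype (P i)] [NormedAddCommGroup E] [InnerProductSpace ℝ E] [FiniteDimensional ℝ E]
  {D : Program V E M P}

namespace Program

/-- The linear parts of the consensus and equality constraints. -/
def constraintMap (D : Program V E M P) : (V → E) →ₗ[ℝ] (V → E) × (∀ i, P i → ℝ) where
  toFun y := (D.lap y, fun i l => (D.h i l).linear (y i))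
  map_add' y y' := by
    refine Prod.ext (funext fun i => ?_) (funext fun i => funext fun l => ?_)
    · simp [lap, blockLap, Finset.sum_add_distrib]
    · simp
  map_smul' c y := by
    refine Prod.ext (funext fun i => ?_) (funext fun i => funext fun l => ?_)
    · simp [lap, blockLap, Finset.smul_sum, smul_comm c]
    · simp

theorem _root_.DistOpt.exists_coordinates (μ : (V → E) × (∀ i, P i → ℝ) →ₗ[ℝ] ℝ) :
    ∃ (a : V → E) (nu : ∀ i, P i → ℝ), ∀ u v,
      μ (u, v) = ∑ i, inner ℝ (a i) (u i) + ∑ i, ∑ l, nu i l * v i l := by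
  classical
  refine ⟨fun i => (InnerProductSpace.toDual ℝ E).symm
    (μ ∘ₗ LinearMap.inl ℝ _ _ ∘ₗ LinearMap.single ℝ (fun _ => E) i).toContinuousLinearMap,
    fun i l => μ (0, Pi.single i (Pi.single l 1)), fun u v => ?_⟩
  have h1 : (u, v) = ∑ i, ((Pi.single i (u i), 0) : (V → E) × (∀ i, P i → ℝ)) +
      ∑ i, ∑ l, v i l • ((0, Pi.single i (Pi.single l 1)) : (V → E) × (∀ i, P i → ℝ)) := by
    refine Prod.ext ?_ ?_
    · simp [Prod.fst_sum, Finset.univ_sum_single]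
    · simp only [Prod.snd_add, Prod.snd_sum, Finset.sum_const_zero, zero_add, Prod.smul_snd]
      ext i l
      rw [Finset.sum_apply, Finset.sum_apply, Finset.sum_eq_single i, Finset.sum_apply,
        Finset.sum_apply, Finset.sum_eq_single l]
      · simp
      · intro k _ hk; simp [hk.symm]
      · simp
      · intro j _ hj; simp [Finset.sum_apply, hj.symm]
      · simp
  rw [h1, map_add, map_sum, map_sum]
  simp only [map_sum, map_smul, smul_eq_mul, InnerProductSpace.toDual_symm_apply]
  congr 1
  exact Finset.sum_congr rfl fun i _ => Finset.sum_congr rfl fun l _ => mul_comm _ _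

/-- Duality is applied to the problem with one copy of `z` per agent and consensus as an equality
constraint. Varying one copy at a time splits the resulting inequality into the local gap
conditions. -/
theorem exists_isSaddle (hG : D.G.Connected) {zs zS : E}
    (hzs : IsOptimal D.f D.g (fun i l => ⇑(D.h i l)) zs)
    (hSg : ∀ i k, D.g i k zS < 0) (hSh : ∀ i l, D.h i l zS = 0) :
    ∃ p, D.IsSaddle zs p := by
  have hα := D.α_pos
  obtain ⟨⟨hg, hh'⟩, hopt⟩ := hzs
  have hh : ∀ i l, D.h i l zs = 0 := hh'
  have hlin : ∀ i l w, (D.h i l).linear (w - zs) = D.h i l w := by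
    intro i l w
    have := (D.h i l).linearMap_vsub w zs
    rw [vsub_eq_sub, vsub_eq_sub, hh, sub_zero] at this
    exact this
  have hT : ∀ z, D.constraintMap z = D.constraintMap (fun _ => zs) ↔
      D.lap z = 0 ∧ ∀ i l, D.h i l (z i) = 0 := by
    intro z
    rw [← sub_eq_zero, ← map_sub]
    have h1 : D.lap (z - fun _ => zs) = D.lap z := by
      ext1 i
      simp [lap, blockLap_eq]
    rw [constraintMap, LinearMap.coe_mk, AddHom.coe_mk, h1, Prod.mk_eq_zero]
    refine and_congr Iff.rfl ?_
    simp [funext_iff, -map_sub, hlin]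
  have hcomp : ∀ (i : V) (ψ : E → ℝ), ConvexOn ℝ Set.univ ψ →
      ConvexOn ℝ Set.univ fun z : V → E => ψ (z i) := fun i ψ hψ =>
    hψ.comp_linearMap (LinearMap.proj i : (V → E) →ₗ[ℝ] E)
  have hΦ : ConvexOn ℝ Set.univ fun z : V → E => ∑ i, D.f i (z i) := by
    refine ⟨convex_univ, fun z _ z' _ a b ha hb hab => ?_⟩
    simp only [smul_eq_mul, Finset.mul_sum, ← Finset.sum_add_distrib]
    exact Finset.sum_le_sum fun i _ =>
      (D.f_convex i).2 (Set.mem_univ (z i)) (Set.mem_univ (z' i)) ha hb hab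
  obtain ⟨c, μ, hc, hmain⟩ := exists_multipliers (K := Σ i, M i) D.constraintMap
    (Φ := fun z => ∑ i, D.f i (z i)) (Γ := fun k z => D.g k.1 k.2 (z k.1)) hΦ (by fun_prop)
    (fun k => hcomp k.1 _ (D.g_convex k.1 k.2)) (fun k => by fun_prop)
    (x₀ := fun _ => zs) (xS := fun _ => zS) (fun z hz hzg => by
      obtain ⟨h1, h2⟩ := (hT z).1 hz
      have h3 : ∀ i j, z i = z j := eq_of_sum_inner_blockLap_eq_zero hG
        (Finset.sum_eq_zero fun i _ => by
          rw [show blockLap D.G z i = 0 from congrFun h1 i, inner_zero_left])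
      obtain ⟨i₀⟩ := hG.nonempty
      have h4 := hopt (z i₀) ⟨fun i k => by rw [h3 i₀ i]; exact hzg ⟨i, k⟩,
        fun i l => by rw [h3 i₀ i]; exact h2 i l⟩
      exact h4.trans (le_of_eq (Finset.sum_congr rfl fun i _ => by rw [h3 i₀ i])))
    ((hT _).2 ⟨funext fun i => blockLap_eq_zero D.G (fun _ _ => rfl) i, hSh⟩)
    (fun k => hSg k.1 k.2)
  obtain ⟨a, nu, hμ⟩ := exists_coordinates μ
  set lam : ∀ i, M i → ℝ := fun i k => c ⟨i, k⟩ with hlam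
  have hkey : ∀ z : V → E, ∑ i, D.f i zs ≤ ∑ i, (D.lagr i (z i) (lam i) (nu i) +
      inner ℝ (D.lap a i) (z i - zs)) := by
    intro z
    refine (hmain z).trans (le_of_eq ?_)
    have h1 : ∑ i, inner ℝ (a i) (D.lap (z - fun _ => zs) i) =
        ∑ i, inner ℝ (D.lap a i) (z i - zs) := by
      simp_rw [real_inner_comm _ (a _)]
      exact sum_inner_blockLap_comm D.G _ _
    have h2 : D.constraintMap (z - fun _ => zs) = (D.lap (z - fun _ => zs),
        fun i l => D.h i l (z i)) := by
      refine Prod.ext rfl (funext fun i => funext fun l => ?_)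
      exact hlin i l (z i)
    rw [h2, hμ, h1, Fintype.sum_sigma]
    simp only [lagr, Finset.sum_add_distrib, hlam]
    ring
  have hcle : ∀ i k, lam i k * D.g i k zs ≤ 0 := fun i k =>
    mul_nonpos_of_nonneg_of_nonpos (hc _) (hg i k)
  have hcompl : ∀ i k, lam i k * D.g i k zs = 0 := by
    have h1 := hkey fun _ => zs
    simp only [lagr, hh, mul_zero, Finset.sum_const_zero, add_zero, sub_self, inner_zero_right,
      Finset.sum_add_distrib] at h1
    have h2 := fun i => Finset.sum_nonpos fun k (_ : k ∈ Finset.univ) => hcle i k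
    intro i k
    have h3 := (Finset.sum_eq_zero_iff_of_nonpos fun i _ => h2 i).1 (le_antisymm
      (Finset.sum_nonpos fun i _ => h2 i) (by linarith)) i (Finset.mem_univ i)
    exact (Finset.sum_eq_zero_iff_of_nonpos fun k _ => hcle i k).1 h3 k (Finset.mem_univ k)
  -- The factor `-α` matches the sign of the `ζ` feedback and the gain carried by the Lagrangian
  -- terms.
  refine ⟨(fun _ => zs, fun i => -(D.α • a i), lam, nu), fun _ => rfl, fun i k => hc _, hg, hh,
    hcompl, fun i w => ?_⟩
  have h1 := hkey (Function.update (fun _ => zs) i w)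
  rw [← Finset.add_sum_erase _ _ (Finset.mem_univ i),
    ← Finset.add_sum_erase _ _ (Finset.mem_univ i), Function.update_self] at h1
  have h2 : ∑ j ∈ Finset.univ.erase i, (D.lagr j (Function.update (fun _ => zs) i w j) (lam j)
      (nu j) + inner ℝ (D.lap a j) (Function.update (fun _ => zs) i w j - zs)) =
      ∑ j ∈ Finset.univ.erase i, D.f j zs := by
    refine Finset.sum_congr rfl fun j hj => ?_
    rw [Function.update_of_ne (Finset.ne_of_mem_erase hj), sub_self, inner_zero_right, add_zero,
      lagr_eq_of_compl _ (hh j) (hcompl j)]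
  rw [h2] at h1
  have h3 : D.lap (fun i => -(D.α • a i)) i = -(D.α • D.lap a i) := by
    simp [lap, blockLap, Finset.smul_sum, smul_comm D.α]
  simp only [gap, h3, inner_neg_left, real_inner_smul_left]
  have h4 := mul_nonneg hα.le (show 0 ≤ D.lagr i w (lam i) (nu i) +
    inner ℝ (D.lap a i) (w - zs) - D.f i zs by linarith)
  linarith

end Program

end Saddle

/-! ### Midpoint estimates and stationary limits -/

section Abstract

variable {V E : Type*} [Fintype V] [DecidableEq V] {M P : V → Type*} [∀ i, Fintype (M i)]
  [∀ i, Fintype (P i)] [NormedAddCommGroup E] [InnerProductSpace ℝ E] [FiniteDimensional ℝ E]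
  {D : Program V E M P}

namespace Program

variable {zs : E} {p : State E M P} {x : ℝ → State E M P}

theorem _root_.DistOpt.affineMap_midpoint (φ : E →ᵃ[ℝ] ℝ) (u v : E) :
    φ (midpoint ℝ u v) = 1 / 2 * φ u + 1 / 2 * φ v := by
  rw [φ.map_midpoint, midpoint_eq_smul_add, smul_eq_mul, invOf_eq_inv]
  ring

theorem _root_.ConvexOn.midpoint_le {φ : E → ℝ} (hφ : ConvexOn ℝ Set.univ φ) (u v : E) :
    φ (midpoint ℝ u v) ≤ 1 / 2 * φ u + 1 / 2 * φ v := by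
  have := hφ.2 (Set.mem_univ u) (Set.mem_univ v) (show (0 : ℝ) ≤ 1 / 2 by norm_num)
    (show (0 : ℝ) ≤ 1 / 2 by norm_num) (by norm_num)
  rw [midpoint_eq_smul_add, invOf_eq_inv, smul_add]
  simpa using this

/-- The constraint terms are convex and the tilt is linear, so any convexity deficit of the cost
lowers the gap at the midpoint. Two zeros of the gap thus force that deficit to vanish. -/
theorem IsSaddle.gap_midpoint_le (hp : D.IsSaddle zs p) (i : V) (u v : E) :
    D.gap zs p i (midpoint ℝ u v) ≤ 1 / 2 * D.gap zs p i u + 1 / 2 * D.gap zs p i v +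
      D.α * (D.f i (midpoint ℝ u v) - (1 / 2 * D.f i u + 1 / 2 * D.f i v)) := by
  have h1 : ∑ k, p.2.2.1 i k * D.g i k (midpoint ℝ u v) ≤
      1 / 2 * ∑ k, p.2.2.1 i k * D.g i k u + 1 / 2 * ∑ k, p.2.2.1 i k * D.g i k v := by
    rw [Finset.mul_sum, Finset.mul_sum, ← Finset.sum_add_distrib]
    refine Finset.sum_le_sum fun k _ => ?_
    have := mul_le_mul_of_nonneg_left ((D.g_convex i k).midpoint_le u v) (hp.nonneg i k)
    linarith
  have h2 : ∑ l, p.2.2.2 i l * D.h i l (midpoint ℝ u v) =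
      1 / 2 * ∑ l, p.2.2.2 i l * D.h i l u + 1 / 2 * ∑ l, p.2.2.2 i l * D.h i l v := by
    rw [Finset.mul_sum, Finset.mul_sum, ← Finset.sum_add_distrib]
    refine Finset.sum_congr rfl fun k _ => ?_
    rw [affineMap_midpoint]
    ring
  have h3 : midpoint ℝ u v - zs = (1 / 2 : ℝ) • (u - zs) + (1 / 2 : ℝ) • (v - zs) := by
    rw [midpoint_eq_smul_add, invOf_eq_inv]
    module
  have h4 := mul_le_mul_of_nonneg_left h1 D.α_pos.le
  simp only [gap, lagr, h2, h3, inner_add_right, real_inner_smul_right]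
  linarith

theorem IsSaddle.gap_self (hp : D.IsSaddle zs p) (i : V) : D.gap zs p i zs = 0 := by
  rw [gap, lagr_eq_of_compl _ (hp.h_eq i) (hp.compl i)]
  simp

theorem IsWeakTrajectory.exists_stationary (hx : D.IsWeakTrajectory x) (hp : D.IsSaddle zs p)
    (hx0 : ∀ t, x t = x (max t 0)) {τ : ℕ → ℝ} (hτ : Tendsto τ atTop atTop) :
    ∃ φ : ℕ → ℕ, StrictMono φ ∧ ∃ y : ℝ → State E M P, D.IsStationary zs p y ∧
      ∀ s, Tendsto (fun k => x (τ (φ k) + s)) atTop (𝓝 (y s)) := by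
  obtain ⟨φ, hφ, y, hy, hlim⟩ := hx.exists_limit hp hx0 hτ
  exact ⟨φ, hφ, y, ⟨hy, hp, hx.lyap_limit hp (hτ.comp hφ.tendsto_atTop) hlim⟩, hlim⟩

end Program

end Abstract

/-- Besides a sequence realising the limit superior, the eventual upper bound is retained: it must
hold at shifted times as well. -/
theorem exists_seq_tendsto_limsup {u : ℝ → ℝ} {C : ℝ} (hu : ∀ t, |u t| ≤ C) :
    ∃ (c : ℝ) (τ : ℕ → ℝ), Tendsto τ atTop atTop ∧ Tendsto (fun k => u (τ k)) atTop (𝓝 c) ∧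
      ∀ ε > 0, ∀ᶠ t in atTop, u t < c + ε := by
  have hb : IsBoundedUnder (· ≤ ·) atTop u :=
    isBoundedUnder_of ⟨C, fun t => (abs_le.1 (hu t)).2⟩
  have hb' : IsBoundedUnder (· ≥ ·) atTop u :=
    isBoundedUnder_of ⟨-C, fun t => (abs_le.1 (hu t)).1⟩
  set c := limsup u atTop
  have hlt : ∀ ε > 0, ∀ᶠ t in atTop, u t < c + ε := fun ε hε =>
    eventually_lt_of_limsup_lt (by linarith) hb
  have hex : ∀ k : ℕ, ∃ t, (k : ℝ) ≤ t ∧ c - 1 / ((k : ℝ) + 1) < u t := fun k => by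
    have h1 : ∃ᶠ t in atTop, c - 1 / ((k : ℝ) + 1) < u t :=
      frequently_lt_of_lt_limsup hb'.isCoboundedUnder_le
        (by linarith [show 0 < 1 / ((k : ℝ) + 1) by positivity])
    obtain ⟨t, ht1, ht2⟩ := (h1.and_eventually (eventually_ge_atTop (k : ℝ))).exists
    exact ⟨t, ht2, ht1⟩
  choose τ hτ1 hτ2 using hex
  have hτ : Tendsto τ atTop atTop := tendsto_atTop_mono hτ1 tendsto_natCast_atTop_atTop
  refine ⟨c, τ, hτ, ?_, hlt⟩
  refine Metric.tendsto_atTop'.2 fun ε hε => ?_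
  obtain ⟨N, hN⟩ := exists_nat_one_div_lt hε
  obtain ⟨N', hN'⟩ := eventually_atTop.1 (hτ.eventually (hlt ε hε))
  refine ⟨max N N', fun k hk => ?_⟩
  rw [Real.dist_eq, abs_lt]
  have h1 := hτ2 k
  have h2 : 1 / ((k : ℝ) + 1) ≤ 1 / ((N : ℝ) + 1) := by
    have : (N : ℝ) ≤ k := by exact_mod_cast (le_max_left N N').trans hk.le
    gcongr
  have h3 := hN' k ((le_max_right N N').trans hk.le)
  constructor <;> linarith

/-! ### The robot network -/

section Robots

variable {n : ℕ}

/-- `refPart` as a linear map. -/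
def refLin (n : ℕ) : ZSpace n →ₗ[ℝ] EuclideanSpace ℝ (Fin 2) where
  toFun := refPart
  map_add' z w := by ext; simp [refPart]
  map_smul' c z := by ext; simp [refPart]

/-- The displacement from `(z_q, z_ξ)` to the replicated reference, as a linear map. -/
def offset (n : ℕ) : ZSpace n →ₗ[ℝ] EuclideanSpace ℝ (PhysIdx n) where
  toFun z := replicate n (refPart z) - physPart z
  map_add' z w := by
    ext s
    rcases s with s | s
    · simp [refPart, physPart, replicate]; ring
    · simp [refPart, physPart, replicate]; ring
  map_smul' c z := by
    ext s
    rcases s with s | s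
    · simp [refPart, physPart, replicate]; ring
    · simp [refPart, physPart, replicate]

/-- The linear part of the first constraint belonging to a row. -/
def rowLin {ρ : ℕ} (A : Matrix (Fin ρ) (PhysIdx n) ℝ) (B : Matrix (Fin ρ) (Fin 2) ℝ)
    (l : Fin ρ) : ZSpace n →ₗ[ℝ] ℝ where
  toFun z := A.mulVec (replicate n (refPart z)) l - B.mulVec (refPart z) l
  map_add' z w := by
    have h1 : (replicate n (refPart (z + w)) : PhysIdx n → ℝ) =
        replicate n (refPart z) + replicate n (refPart w) := by
      ext s
      rcases s with s | s <;> simp [refPart, replicate]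
    have h2 : (refPart (z + w) : Fin 2 → ℝ) = refPart z + refPart w := by
      ext s; simp [refPart]
    rw [h1, h2, Matrix.mulVec_add, Matrix.mulVec_add, Pi.add_apply, Pi.add_apply]
    ring
  map_smul' c z := by
    have h1 : (replicate n (refPart (c • z)) : PhysIdx n → ℝ) =
        c • (replicate n (refPart z) : PhysIdx n → ℝ) := by
      ext s
      rcases s with s | s <;> simp [refPart, replicate]
    have h2 : (refPart (c • z) : Fin 2 → ℝ) = c • (refPart z : Fin 2 → ℝ) := by
      ext s; simp [refPart]
    rw [h1, h2, Matrix.mulVec_smul, Matrix.mulVec_smul, Pi.smul_apply, Pi.smul_apply,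
      smul_eq_mul, smul_eq_mul, RingHom.id_apply, smul_eq_mul]
    ring

variable {ρ : ℕ} (A : Matrix (Fin ρ) (PhysIdx n) ℝ) (b : Fin ρ → ℝ)
  (B : Matrix (Fin ρ) (Fin 2) ℝ)

theorem ineq_inl (l : Fin ρ) (z : ZSpace n) :
    ineq A b B (Sum.inl l) z = rowLin A B l z - b l := by
  simp only [ineq, rowLin, LinearMap.coe_mk, AddHom.coe_mk]
  ring

theorem ineq_inr (l : Fin ρ) (z : ZSpace n) :
    ineq A b B (Sum.inr l) z = ‖offset n z‖ -
      1 / ‖(WithLp.toLp 2 (A l) : EuclideanSpace ℝ (PhysIdx n))‖ * (b l - rowLin A B l z) := by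
  simp only [ineq, rowLin, offset, LinearMap.coe_mk, AddHom.coe_mk]
  ring

theorem rowLin_congr (l : Fin ρ) {z w : ZSpace n} (h : refPart z = refPart w) :
    rowLin A B l z = rowLin A B l w := by
  simp [rowLin, h]

theorem continuous_ineq (k : Fin ρ ⊕ Fin ρ) : Continuous (ineq A b B k) := by
  have h1 := fun l => (rowLin A B l).continuous_of_finiteDimensional
  have h2 := (offset n).continuous_of_finiteDimensional
  rcases k with l | l
  · simp_rw [funext (ineq_inl A b B l)]
    have := h1 l
    fun_prop
  · simp_rw [funext (ineq_inr A b B l)]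
    have := h1 l
    fun_prop

theorem convexOn_ineq (k : Fin ρ ⊕ Fin ρ) : ConvexOn ℝ Set.univ (ineq A b B k) := by
  rcases k with l | l
  · rw [funext (ineq_inl A b B l)]
    exact ((rowLin A B l).convexOn convex_univ).sub (concaveOn_const _ convex_univ)
  · rw [funext (ineq_inr A b B l)]
    refine ((convexOn_norm convex_univ).comp_linearMap (offset n)).sub ?_
    have h1 : ConcaveOn ℝ Set.univ fun z => b l - rowLin A B l z :=
      (concaveOn_const _ convex_univ).sub ((rowLin A B l).convexOn convex_univ)
    exact h1.smul (by positivity)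

theorem differentiable_ineq_inl (l : Fin ρ) : Differentiable ℝ (ineq A b B (Sum.inl l)) := by
  rw [funext (ineq_inl A b B l)]
  exact (rowLin A B l).toContinuousLinearMap.differentiable.sub_const _

theorem differentiableAt_ineq_inr (l : Fin ρ) {z : ZSpace n} (hz : offset n z ≠ 0) :
    DifferentiableAt ℝ (ineq A b B (Sum.inr l)) z := by
  rw [funext (ineq_inr A b B l)]
  have h1 : DifferentiableAt ℝ (fun z => rowLin A B l z) z :=
    (rowLin A B l).toContinuousLinearMap.differentiableAt
  have h2 : DifferentiableAt ℝ (fun z => offset n z) z :=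
    (offset n).toContinuousLinearMap.differentiableAt
  exact (h2.norm ℝ hz).sub ((h1.const_sub _).const_mul _)

variable (Vh : Finset (Fin n)) (r : EuclideanSpace ℝ (Fin 2))

theorem cost_eq (i : Fin n) (z : ZSpace n) :
    cost Vh r i z = (if i ∈ Vh then 1 else 0) * ‖r - refLin n z‖ ^ 2 := by
  simp only [cost, refLin, LinearMap.coe_mk, AddHom.coe_mk, ite_mul, one_mul, zero_mul]

theorem convexOn_cost (i : Fin n) : ConvexOn ℝ Set.univ (cost Vh r i) := by
  rw [funext (cost_eq Vh r i)]
  have h1 : ConvexOn ℝ Set.univ fun v : EuclideanSpace ℝ (Fin 2) => ‖r - v‖ ^ 2 := by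
    refine ConvexOn.pow ?_ (fun _ _ => norm_nonneg _) 2
    refine ⟨convex_univ, fun u _ v _ a b ha hb hab => ?_⟩
    have : r - (a • u + b • v) = a • (r - u) + b • (r - v) := by
      nth_rewrite 1 [← one_smul ℝ r, ← hab]
      module
    simp only [this]
    refine (norm_add_le _ _).trans_eq ?_
    rw [norm_smul, norm_smul, Real.norm_of_nonneg ha, Real.norm_of_nonneg hb]
    rfl
  exact (h1.comp_linearMap (refLin n)).smul (by split_ifs <;> norm_num)

theorem differentiable_cost (i : Fin n) : Differentiable ℝ (cost Vh r i) := by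
  rw [funext (cost_eq Vh r i)]
  have h1 : Differentiable ℝ (fun z => refLin n z) :=
    (refLin n).toContinuousLinearMap.differentiable
  exact ((h1.const_sub r).norm_sq ℝ).const_mul _

theorem cost_midpoint {i : Fin n} (hi : i ∈ Vh) (u v : ZSpace n) :
    cost Vh r i (midpoint ℝ u v) = 1 / 2 * cost Vh r i u + 1 / 2 * cost Vh r i v -
      1 / 4 * ‖refPart u - refPart v‖ ^ 2 := by
  have h1 : refPart (midpoint ℝ u v) = (1 / 2 : ℝ) • refPart u + (1 / 2 : ℝ) • refPart v := by
    rw [midpoint_eq_smul_add, invOf_eq_inv]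
    ext a
    simp [refPart]
  have h2 : r - refPart (midpoint ℝ u v) =
      (1 / 2 : ℝ) • ((r - refPart u) + (r - refPart v)) := by
    rw [h1]; module
  have h3 : refPart u - refPart v = -((r - refPart u) - (r - refPart v)) := by abel
  simp only [cost, if_pos hi]
  rw [h2, h3, norm_neg, norm_smul, mul_pow]
  generalize r - refPart u = a
  generalize r - refPart v = c
  rw [norm_add_sq_real, norm_sub_sq_real]
  norm_num
  ring

theorem sum_cost (z : ZSpace n) : ∑ i, cost Vh r i z = Vh.card * ‖r - refPart z‖ ^ 2 := by
  simp [cost, Finset.sum_ite_mem]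

theorem ext_of_refPart {q ξ : Fin n → EuclideanSpace ℝ (Fin 2)} {z w : ZSpace n}
    (h : refPart z = refPart w) (hz : ∀ i, AgreesAt q ξ i z) (hw : ∀ i, AgreesAt q ξ i w) :
    z = w := by
  ext s
  rcases s with a | ⟨i, a⟩ | ⟨i, a⟩
  · exact congrFun (congrArg WithLp.ofLp h) a
  · rw [(hz i).1 a, (hw i).1 a]
  · rw [(hz i).2 a, (hw i).2 a]

theorem inner_zspace (z w : ZSpace n) :
    inner ℝ z w = ∑ a, z (Sum.inl a) * w (Sum.inl a) + ∑ s, z (Sum.inr s) * w (Sum.inr s) := by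
  simp [PiLp.inner_apply, mul_comm]

end Robots

/-! ### Optimality and convergence for the robot network -/

section Main

variable {n : ℕ} {Vh : Finset (Fin n)} {r : EuclideanSpace ℝ (Fin 2)}
  {q ξ : Fin n → EuclideanSpace ℝ (Fin 2)} {ρ : Fin n → ℕ}
  {A : ∀ i, Matrix (Fin (ρ i)) (PhysIdx n) ℝ} {b : ∀ i, Fin (ρ i) → ℝ}
  {B : ∀ i, Matrix (Fin (ρ i)) (Fin 2) ℝ} {p : Fin n → ℕ}
  {h : ∀ i, Fin (p i) → (ZSpace n →ᵃ[ℝ] ℝ)}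

/-- Feasible points share their physical part, so minimising the cost amounts to projecting the
point `c`, made of `r` and that physical part, onto a closed set. -/
theorem exists_isOptimal (hh : ∀ i z, (∀ l, h i l z = 0) ↔ AgreesAt q ξ i z)
    (hS : Slater (fun i => ineq (A i) (b i) (B i)) (fun i l => ⇑(h i l))) :
    ∃ z, IsOptimal (cost Vh r) (fun i => ineq (A i) (b i) (B i)) (fun i l => ⇑(h i l)) z := by
  obtain ⟨zS, hSg, hSh⟩ := hS
  set F : Set (ZSpace n) := {z | IsFeasible (fun i => ineq (A i) (b i) (B i))
    (fun i l => ⇑(h i l)) z} with hF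
  have hFc : IsClosed F := by
    refine IsClosed.and ?_ ?_
    · simp only [Set.ofPred_forall]
      exact isClosed_iInter fun i => isClosed_iInter fun k =>
        isClosed_le (continuous_ineq _ _ _ k) continuous_const
    · simp only [Set.ofPred_forall]
      exact isClosed_iInter fun i => isClosed_iInter fun l =>
        isClosed_eq (h i l).continuous_of_finiteDimensional continuous_const
  have hFne : F.Nonempty := ⟨zS, fun i k => (hSg i k).le, hSh⟩
  let c : ZSpace n := WithLp.toLp 2 (Sum.elim r fun s => zS (Sum.inr s))
  obtain ⟨z, hzF, hz⟩ := hFc.exists_infDist_eq_dist hFne c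
  have hdist : ∀ w ∈ F, dist c w = ‖r - refPart w‖ := by
    intro w hw
    have h1 : ∀ s, zS (Sum.inr s) = w (Sum.inr s) := by
      rintro (⟨i, a⟩ | ⟨i, a⟩)
      · rw [((hh i zS).1 (hSh i)).1, ((hh i w).1 (hw.2 i)).1]
      · rw [((hh i zS).1 (hSh i)).2, ((hh i w).1 (hw.2 i)).2]
    rw [dist_eq_norm, EuclideanSpace.norm_eq, EuclideanSpace.norm_eq, Fintype.sum_sum_type]
    congr 1
    simp [c, h1, refPart]
  refine ⟨z, hzF, fun w hw => ?_⟩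
  rw [sum_cost, sum_cost]
  have h1 : ‖r - refPart z‖ ≤ ‖r - refPart w‖ := by
    rw [← hdist z hzF, ← hdist w hw, ← hz]
    exact Metric.infDist_le_dist_of_mem hw
  gcongr

theorem refPart_eq_of_isOptimal (hVh : Vh.Nonempty) {z w : ZSpace n}
    (hz : IsOptimal (cost Vh r) (fun i => ineq (A i) (b i) (B i)) (fun i l => ⇑(h i l)) z)
    (hw : IsOptimal (cost Vh r) (fun i => ineq (A i) (b i) (B i)) (fun i l => ⇑(h i l)) w) :
    refPart z = refPart w := by
  have hm : IsFeasible (fun i => ineq (A i) (b i) (B i)) (fun i l => ⇑(h i l))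
      (midpoint ℝ z w) := by
    refine ⟨fun i k => ?_, fun i l => ?_⟩
    · have h1 := (convexOn_ineq (A i) (b i) (B i) k).midpoint_le z w
      have h2 := hz.1.1 i k
      have h3 := hw.1.1 i k
      simp only at h2 h3 ⊢
      linarith
    · have h1 := affineMap_midpoint (h i l) z w
      have h2 := hz.1.2 i l
      have h3 := hw.1.2 i l
      simp only at h2 h3 ⊢
      rw [h1, h2, h3]
      norm_num
  have h1 := hz.2 _ hm
  have h2 := hw.2 _ hz.1
  obtain ⟨i, hi⟩ := hVh
  have hN : (0 : ℝ) < Vh.card := by exact_mod_cast Finset.card_pos.2 ⟨i, hi⟩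
  have h3 := cost_midpoint Vh r hi z w
  simp only [cost, if_pos hi] at h3
  rw [sum_cost, sum_cost] at h1 h2
  have h4 := le_of_mul_le_mul_left h1 hN
  have h5 := le_of_mul_le_mul_left h2 hN
  have h6 : ‖refPart z - refPart w‖ ^ 2 ≤ 0 := by linarith
  have h7 : ‖refPart z - refPart w‖ = 0 := by
    nlinarith [norm_nonneg (refPart z - refPart w)]
  exact sub_eq_zero.1 (norm_eq_zero.1 h7)

/-- Agent `i`'s equalities see only its own blocks. With at least two agents, every coordinate
direction is invisible to some agent. -/
theorem eq_zero_of_inner_eq_zero (hn : 2 ≤ n)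
    (hh : ∀ i z, (∀ l, h i l z = 0) ↔ AgreesAt q ξ i z) {zs : ZSpace n}
    (hzs : ∀ i l, h i l zs = 0) {v : ZSpace n}
    (hv : ∀ i e, (∀ l, (h i l).linear e = 0) → inner ℝ v e = (0 : ℝ)) : v = 0 := by
  have hlin : ∀ i e, AgreesAt q ξ i (zs + e) → ∀ l, (h i l).linear e = 0 := by
    intro i e he l
    have h1 := (h i l).linearMap_vsub (zs + e) zs
    rw [vsub_eq_sub, vsub_eq_sub, (hh i _).2 he l, hzs, sub_zero, add_sub_cancel_left] at h1
    exact h1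
  have hag := fun i => (hh i zs).1 (hzs i)
  have : Nontrivial (Fin n) := Fin.nontrivial_iff_two_le.2 hn
  ext s
  suffices hi : ∃ i, AgreesAt q ξ i (zs + EuclideanSpace.single s (1 : ℝ)) by
    obtain ⟨i, hi⟩ := hi
    have h1 := hv i _ (hlin i _ hi)
    simpa [EuclideanSpace.inner_single_right] using h1
  rcases s with a | ⟨j, a⟩ | ⟨j, a⟩
  · obtain ⟨i, -⟩ := exists_ne (⟨0, by omega⟩ : Fin n)
    exact ⟨i, fun a => by simp [(hag i).1 a], fun a => by simp [(hag i).2 a]⟩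
  · obtain ⟨i, hi⟩ := exists_ne j
    exact ⟨i, fun a => by simp [(hag i).1 a, hi], fun a => by simp [(hag i).2 a]⟩
  · obtain ⟨i, hi⟩ := exists_ne j
    exact ⟨i, fun a => by simp [(hag i).1 a], fun a => by simp [(hag i).2 a, hi]⟩

variable (Vh r A b B h) in
/-- The program of the robot network. -/
def robotProgram (G : SimpleGraph (Fin n)) [inst : DecidableRel G.Adj] {α : ℝ} (hα : 0 < α) :
    Program (Fin n) (ZSpace n) (fun i => Fin (ρ i) ⊕ Fin (ρ i)) (fun i => Fin (p i)) where
  G := G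
  decAdj := inst
  α := α
  f := cost Vh r
  g i := ineq (A i) (b i) (B i)
  h := h
  α_pos := hα
  f_convex := convexOn_cost Vh r
  f_diff := differentiable_cost Vh r
  g_convex i k := convexOn_ineq (A i) (b i) (B i) k
  g_cont i k := continuous_ineq (A i) (b i) (B i) k

variable {G : SimpleGraph (Fin n)} [DecidableRel G.Adj] {α : ℝ} {hα : 0 < α} {zs : ZSpace n}
  {s₀ : State (ZSpace n) (fun i => Fin (ρ i) ⊕ Fin (ρ i)) (fun i => Fin (p i))}
  {y x : ℝ → State (ZSpace n) (fun i => Fin (ρ i) ⊕ Fin (ρ i)) (fun i => Fin (p i))}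

/-- A leader's gap vanishes at both the estimate and `zs`. If their references differed, strict
convexity would make the gap negative at the midpoint. -/
theorem refPart_eq_of_stationary (hVh : Vh.Nonempty) (hG : G.Connected)
    (hy : (robotProgram Vh r A b B h G hα).IsStationary zs s₀ y) {s : ℝ} (hs : 0 ≤ s)
    (j : Fin n) : refPart ((y s).1 j) = refPart zs := by
  obtain ⟨i, hi⟩ := hVh
  rw [hy.consensus hG hs j i]
  have h1 := hy.saddle.gap_midpoint_le i ((y s).1 i) zs
  rw [hy.gap_eq_zero hs, hy.saddle.gap_self] at h1
  have h2 := (hy.saddle.gap_nonneg i _).trans h1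
  have h3 : (robotProgram Vh r A b B h G hα).f i (midpoint ℝ ((y s).1 i) zs) -
      (1 / 2 * (robotProgram Vh r A b B h G hα).f i ((y s).1 i) +
        1 / 2 * (robotProgram Vh r A b B h G hα).f i zs) =
      -(1 / 4 * ‖refPart ((y s).1 i) - refPart zs‖ ^ 2) := by
    change cost Vh r i _ - (1 / 2 * cost Vh r i _ + 1 / 2 * cost Vh r i _) = _
    rw [cost_midpoint Vh r hi]
    ring
  rw [h3] at h2
  have h4 : 0 < (robotProgram Vh r A b B h G hα).α := hα
  have h5 : ‖refPart ((y s).1 i) - refPart zs‖ ^ 2 ≤ 0 := by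
    by_contra! h6
    nlinarith [mul_pos h4 h6]
  have h6 : ‖refPart ((y s).1 i) - refPart zs‖ = 0 := by
    nlinarith [norm_nonneg (refPart ((y s).1 i) - refPart zs)]
  exact sub_eq_zero.1 (norm_eq_zero.1 h6)

theorem stationary_eq_of_differentiable (hn : 2 ≤ n) (hVh : Vh.Nonempty) (hG : G.Connected)
    (hh : ∀ i z, (∀ l, h i l z = 0) ↔ AgreesAt q ξ i z) {zS : ZSpace n}
    (hSg : ∀ i k, ineq (A i) (b i) (B i) k zS < 0) (hSh : ∀ i l, h i l zS = 0)
    (hI : ∀ i l, ineq (A i) (b i) (B i) (Sum.inr l) zs = 0 → offset n zs ≠ 0)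
    (hy : (robotProgram Vh r A b B h G hα).IsStationary zs s₀ y) {s : ℝ} (hs : 0 ≤ s)
    (i : Fin n) : (y s).1 i = zs := by
  have hzs : ∀ i l, h i l zs = 0 := hy.saddle.h_eq
  have href : ∀ s, 0 ≤ s → ∀ j, refPart ((y s).1 j) = refPart zs := fun s hs j =>
    refPart_eq_of_stationary hVh hG hy hs j
  have hyc := hy.weak.cont
  have hoff := (offset n).continuous_of_finiteDimensional
  -- The reference is fixed, so along `y` an active row constraint stays zero, while every active
  -- norm constraint differs from its value at `zs` by this same `σ`.
  have key := fun {s : ℝ} (hs : 0 ≤ s) j =>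
    hy.const_of_differentiable hG (zS := zS) (σ := fun s => ‖offset n ((y s).1 i)‖ -
      ‖offset n zs‖) ?_ hSg hSh ?_ (by fun_prop) ?_ ?_ hs j
  · have h1 := key hs
    have h2 : ∀ j l, h j l ((y 0).1 i) = 0 := by
      intro j l
      rw [hy.consensus hG le_rfl i j]
      exact (h1 j).2 l
    rw [(h1 i).1]
    exact ext_of_refPart (href 0 le_rfl i) (fun j => (hh j _).1 (h2 j))
      (fun j => (hh j _).1 (hzs j))
  · rintro i (l | l) hk
    · exact differentiable_ineq_inl _ _ _ l zs
    · exact differentiableAt_ineq_inr _ _ _ l (hI i l hk)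
  · intro s hs j
    rw [inner_zspace]
    have h1 : ∀ a, ((y s).1 j - zs) (Sum.inl a) = 0 := by
      intro a
      have := congrFun (congrArg WithLp.ofLp (href s hs j)) a
      exact sub_eq_zero.2 this
    have h2 : ∀ t, (zS - zs) (Sum.inr t) = 0 := by
      rintro (⟨i, a⟩ | ⟨i, a⟩)
      · exact sub_eq_zero.2 ((((hh i zS).1 (hSh i)).1 a).trans (((hh i zs).1 (hzs i)).1 a).symm)
      · exact sub_eq_zero.2 ((((hh i zS).1 (hSh i)).2 a).trans (((hh i zs).1 (hzs i)).2 a).symm)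
    simp only [h1, h2, zero_mul, mul_zero, Finset.sum_const_zero, add_zero]
  · rintro j (l | l) hk s hs
    · left
      change ineq (A j) (b j) (B j) (Sum.inl l) zs = 0 at hk
      change ineq (A j) (b j) (B j) (Sum.inl l) _ = 0
      rw [ineq_inl, rowLin_congr _ _ _ (href s hs j), ← ineq_inl, hk]
    · right
      change ineq (A j) (b j) (B j) (Sum.inr l) zs = 0 at hk
      change ineq (A j) (b j) (B j) (Sum.inr l) _ = _
      rw [ineq_inr] at hk ⊢
      rw [rowLin_congr _ _ _ (href s hs j), hy.consensus hG hs i j]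
      linarith
  · exact fun v hv => eq_zero_of_inner_eq_zero hn hh hzs hv

/-- At the kink the affine part of the active constraint is zero and stays so, since it depends only
on `m`. The constraint therefore equals the norm of the offset, whose integral is bounded by the
growth of a multiplier that `hmax` forbids to grow. -/
theorem stationary_eq_of_kink (hVh : Vh.Nonempty) (hG : G.Connected) {i₀ : Fin n}
    {l₀ : Fin (ρ i₀)} (hact : ineq (A i₀) (b i₀) (B i₀) (Sum.inr l₀) zs = 0)
    (hoff : offset n zs = 0) (hy : (robotProgram Vh r A b B h G hα).IsStationary zs s₀ y)
    (hmax : ∀ s, 0 ≤ s → (y s).2.2.1 i₀ (Sum.inr l₀) ≤ (y 0).2.2.1 i₀ (Sum.inr l₀))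
    {s : ℝ} (hs : 0 ≤ s) (i : Fin n) : (y s).1 i = zs := by
  have href : ∀ s, 0 ≤ s → ∀ j, refPart ((y s).1 j) = refPart zs := fun s hs j =>
    refPart_eq_of_stationary hVh hG hy hs j
  have hyc := hy.weak.cont
  have hoffc := (offset n).continuous_of_finiteDimensional
  have hg : ∀ s, 0 ≤ s → ineq (A i₀) (b i₀) (B i₀) (Sum.inr l₀) ((y s).1 i₀) =
      ‖offset n ((y s).1 i₀)‖ := by
    intro s hs
    rw [ineq_inr] at hact ⊢
    rw [rowLin_congr _ _ _ (href s hs i₀)]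
    rw [hoff, norm_zero] at hact
    linarith
  have hint : ∀ a b', 0 ≤ a → a ≤ b' → ∫ t in a..b', ‖offset n ((y t).1 i₀)‖ ≤
      (y b').2.2.1 i₀ (Sum.inr l₀) - (y a).2.2.1 i₀ (Sum.inr l₀) := by
    intro a b' ha hab
    refine le_trans (le_of_eq ?_) (hy.lam_ge hG i₀ (Sum.inr l₀) ha hab)
    refine intervalIntegral.integral_congr fun t ht => ?_
    rw [Set.uIcc_of_le hab] at ht
    exact (hg t (ha.trans ht.1)).symm
  have hnn : ∀ a b', a ≤ b' → 0 ≤ ∫ t in a..b', ‖offset n ((y t).1 i₀)‖ := fun a b' hab =>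
    intervalIntegral.integral_nonneg hab fun t _ => norm_nonneg _
  have hzero : ‖offset n ((y s).1 i₀)‖ = 0 := by
    refine eq_of_integral_eq_mul (φ := fun t => ‖offset n ((y t).1 i₀)‖) (by fun_prop)
      fun b' hb => ?_
    rw [mul_zero]
    refine le_antisymm ?_ (hnn s b' hb)
    have h1 := hint s b' hs hb
    have h2 := (hnn 0 s hs).trans (hint 0 s le_rfl hs)
    linarith [hmax b' (hs.trans hb)]
  rw [hy.consensus hG hs i i₀]
  have h1 : replicate n (refPart ((y s).1 i₀)) = physPart ((y s).1 i₀) :=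
    sub_eq_zero.1 (norm_eq_zero.1 hzero)
  have h2 : replicate n (refPart zs) = physPart zs := sub_eq_zero.1 hoff
  rw [href s hs i₀, h2] at h1
  ext t
  rcases t with a | t
  · exact congrFun (congrArg WithLp.ofLp (href s hs i₀)) a
  · exact (congrFun (congrArg WithLp.ofLp h1) t).symm

theorem tendsto_of_isWeakTrajectory (hn : 2 ≤ n) (hVh : Vh.Nonempty) (hG : G.Connected)
    (hh : ∀ i z, (∀ l, h i l z = 0) ↔ AgreesAt q ξ i z) {zS : ZSpace n}
    (hSg : ∀ i k, ineq (A i) (b i) (B i) k zS < 0) (hSh : ∀ i l, h i l zS = 0)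
    (hp : (robotProgram Vh r A b B h G hα).IsSaddle zs s₀)
    (hx : (robotProgram Vh r A b B h G hα).IsWeakTrajectory x) (hx0 : ∀ t, x t = x (max t 0))
    (i : Fin n) : Tendsto (fun t => (x t).1 i) atTop (𝓝 zs) := by
  suffices hlim : ∃ (τ : ℕ → ℝ) (y : ℝ → State (ZSpace n) (fun i => Fin (ρ i) ⊕ Fin (ρ i))
      (fun i => Fin (p i))), Tendsto τ atTop atTop ∧
      (robotProgram Vh r A b B h G hα).IsStationary zs s₀ y ∧
      Tendsto (fun k => x (τ k)) atTop (𝓝 (y 0)) ∧ ∀ s, 0 ≤ s → ∀ i, (y s).1 i = zs by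
    obtain ⟨τ, y, hτ, hy, hyl, hyz⟩ := hlim
    have h1 := hx.tendsto_of_limit_isSaddle hτ
      (hy.isSaddle hG fun s hs i => hyz s hs.1 i) hyl
    have h2 : Continuous fun w : State (ZSpace n) (fun i => Fin (ρ i) ⊕ Fin (ρ i))
      (fun i => Fin (p i)) => w.1 i := by fun_prop
    have h3 := (h2.tendsto _).comp h1
    rw [hyz 0 le_rfl i] at h3
    exact h3
  -- The dichotomy is whether some norm constraint active at `zs` sits at its kink.
  by_cases hI : ∀ i l, ineq (A i) (b i) (B i) (Sum.inr l) zs = 0 → offset n zs ≠ 0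
  · obtain ⟨φ, hφ, y, hy, hlim⟩ := hx.exists_stationary hp hx0 tendsto_natCast_atTop_atTop
    refine ⟨fun k => (φ k : ℝ), y, tendsto_natCast_atTop_atTop.comp hφ.tendsto_atTop, hy, ?_,
      fun s hs i => stationary_eq_of_differentiable hn hVh hG hh hSg hSh hI hy hs i⟩
    simpa using hlim 0
  · push Not at hI
    obtain ⟨i₀, l₀, hact, hoff⟩ := hI
    obtain ⟨C, hC⟩ := (Metric.isBounded_iff_subset_closedBall 0).1 (hx.isBounded hp hx0)
    have hbd : ∀ t, |(x t).2.2.1 i₀ (Sum.inr l₀)| ≤ C := by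
      intro t
      have h1 := hC (Set.mem_range_self t)
      rw [mem_closedBall_zero_iff] at h1
      rw [← Real.norm_eq_abs]
      exact ((norm_le_pi_norm _ _).trans (norm_le_pi_norm (x t).2.2.1 i₀)).trans
        ((norm_fst_le (x t).2.2).trans ((norm_snd_le (x t).2).trans
          ((norm_snd_le (x t)).trans h1)))
    -- Translating along times that realise the limit superior makes the limiting multiplier maximal
    -- at time `0`, as `stationary_eq_of_kink` requires.
    obtain ⟨c, τ, hτ, hτc, hlt⟩ := exists_seq_tendsto_limsup hbd
    obtain ⟨φ, hφ, y, hy, hlim⟩ := hx.exists_stationary hp hx0 hτ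
    have hτφ := hτ.comp hφ.tendsto_atTop
    have hc : Continuous fun w : State (ZSpace n) (fun i => Fin (ρ i) ⊕ Fin (ρ i))
      (fun i => Fin (p i)) => w.2.2.1 i₀ (Sum.inr l₀) := by fun_prop
    have h0 : (y 0).2.2.1 i₀ (Sum.inr l₀) = c := by
      have h1 := hlim 0
      simp only [add_zero] at h1
      exact tendsto_nhds_unique ((hc.tendsto _).comp h1) (hτc.comp hφ.tendsto_atTop)
    refine ⟨τ ∘ φ, y, hτφ, hy, by simpa using hlim 0, fun s hs i =>
      stationary_eq_of_kink hVh hG hact hoff hy (fun s hs => ?_) hs i⟩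
    rw [h0]
    refine le_of_forall_pos_le_add fun ε hε => ?_
    refine le_of_tendsto ((hc.tendsto _).comp (hlim s)) ?_
    filter_upwards [(tendsto_atTop_add_const_right _ s hτφ).eventually (hlt ε hε)] with k hk
    exact hk.le

end Main

end DistOpt

end

theorem mainTheorem1
    -- a network of at least two robots with a fixed, undirected, connected graph
    (n : ℕ) (hn : 2 ≤ n)
    (G : SimpleGraph (Fin n)) [DecidableRel G.Adj] (hG : G.Connected)
    -- the leaders, their reference, and the static state of the robots
    (Vh : Finset (Fin n)) (hVh : Vh.Nonempty)
    (r : EuclideanSpace ℝ (Fin 2)) (q ξ : Fin n → EuclideanSpace ℝ (Fin 2))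
    -- the local polyhedral constraint data `A i x ≤ b i + B i m`
    (ρ : Fin n → ℕ)
    (A : ∀ i, Matrix (Fin (ρ i)) (DistOpt.PhysIdx n) ℝ) (hA : ∀ i l, A i l ≠ 0)
    (b : ∀ i, Fin (ρ i) → ℝ) (B : ∀ i, Matrix (Fin (ρ i)) (Fin 2) ℝ)
    -- the local affine equality constraints `h i z = 0`
    (p : Fin n → ℕ)
    (h : ∀ i, Fin (p i) → (DistOpt.ZSpace n →ᵃ[ℝ] ℝ))
    (hh : ∀ i z, (∀ l, h i l z = 0) ↔ DistOpt.AgreesAt q ξ i z)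
    (hS : DistOpt.Slater (fun i => DistOpt.ineq (A i) (b i) (B i)) (fun i l => ⇑(h i l)))
    (α : ℝ) (hα : 0 < α) :
    ∃ zStar : DistOpt.ZSpace n,
      (∀ w, DistOpt.IsOptimal (DistOpt.cost Vh r)
          (fun i => DistOpt.ineq (A i) (b i) (B i)) (fun i l => ⇑(h i l)) w ↔ w = zStar) ∧
      ∀ (z ζ : Fin n → ℝ → DistOpt.ZSpace n)
        (lam : ∀ i, Fin (ρ i) ⊕ Fin (ρ i) → ℝ → ℝ) (nu : ∀ i, Fin (p i) → ℝ → ℝ),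
        DistOpt.IsTrajectory G α (DistOpt.cost Vh r)
          (fun i => DistOpt.ineq (A i) (b i) (B i)) (fun i l => ⇑(h i l)) z ζ lam nu →
        ∀ i, Filter.Tendsto (z i) Filter.atTop (nhds zStar) := by
  obtain ⟨zs, hzs⟩ := DistOpt.exists_isOptimal (Vh := Vh) (r := r) hh hS
  obtain ⟨zS, hSg, hSh⟩ := hS
  refine ⟨zs, fun w => ⟨fun hw => ?_, fun hw => hw ▸ hzs⟩, fun z ζ lam nu ht i => ?_⟩
  · exact DistOpt.ext_of_refPart (DistOpt.refPart_eq_of_isOptimal hVh hw hzs)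
      (fun i => (hh i w).1 (hw.1.2 i)) (fun i => (hh i zs).1 (hzs.1.2 i))
  · obtain ⟨s₀, hp⟩ := (DistOpt.robotProgram Vh r A b B h G hα).exists_isSaddle hG hzs hSg hSh
    have hx := (DistOpt.robotProgram Vh r A b B h G hα).isWeakTrajectory_of_isTrajectory ht
    have h1 := DistOpt.tendsto_of_isWeakTrajectory hn hVh hG hh hSg hSh hp hx
      (fun t => by simp only [max_assoc, max_self]) i
    refine h1.congr' ?_
    filter_upwards [Filter.eventually_ge_atTop 0] with t ht0
    simp only [max_eq_left ht0]
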